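/- **Setting.** All sequences are indexed from $1$; $\mathbb N=\{1,2,\dots\}$. For a predicate $P$ on $\mathbb N$, $\mathrm{Prob}\{n: P(n)\}=\lim_{n\to\infty}\frac1n\#\{k\le n: P(k)\}$. The fractional parts of a real sequence $(x_n)$ are *equidistributed* if $\mathrm{Prob}\{n:\{x_n\}\le\beta\}=\beta$ for all $\beta\in[0,1]$. For a tuple $\epsilon=(\epsilon(1),\dots,\epsilon(t))$ of non-negative integers and a sequence $Q$, put $\epsilon*Q=\sum_{k=1}^t\epsilon(k)Q_{t-k+1}$ and $\epsilon\cdot Q=\sum_{k=1}^t\epsilon(k)Q_k$; for an infinite tuple $\mu$ put $\mu\cdot Q=\sum_{k\ge1}\mu(k)Q_k$ and $\mu|s=(\mu(1),\dots,\mu(s))$. Let $L=(a_1,\dots,a_N)$ be non-negative integers with $N\ge2$ and $a_1>0$, and let $\Theta$ be the infinite tuple in which $L$ repeats. Let $\mathcal H^\circ$ be the recursively defined set of finite tuples that are either $\Theta|s$ for some $s\ge0$, or $\Theta|s$ followed by an entry smaller than $\Theta(s+1)$ and then by a (possibly empty) member of $\mathcal H^\circ$. Let $\mathcal H=\{\epsilon\in\mathcal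 H^\circ:\epsilon(1)>0\}$. Let $H$ be the fundamental sequence of $\mathcal H$: the increasing sequence of positive integers such that every $n\in\mathbb N$ is $\epsilon*H$ for exactly one $\epsilon\in\mathcal H$. Let $\psi$ be the dominant (largest) real zero of $x^N-\sum_{k=1}^{N-1}a_kx^{N-k}-(1+a_N)$, $\theta=\psi^{-1}$ and $\widehat H_n=\theta^{n-1}$. **Leading blocks.** If $n=\epsilon*H$ with $\epsilon\in\mathcal H$ of length at least $s\ge 1$, then $\mathrm{LB}_s(n)$ is $(\epsilon(1),\dots,\epsilon(s))$, filled up with zeros to length $N$ if $s<N$; otherwise $\mathrm{LB}_s(n)$ is undefined. If $s\ge N$, let $\mathcal H_s$ be the set of leading blocks of length $s$ occurring in the expansions of $\mathbb N$; if $1\le s<N$, let $\mathcal H_s$ be the set of leading blocks of length $N$ that occur and whose entries after the $s$-th are zero. For $\mathbf b\in\mathcal H_s$, $\widetilde{\mathbf b}$ is the member of $\mathcal H_s$ with $(\widetilde{\mathbf b}|s)*H=1+(\mathbf b|s)*H$ if there is one; for the largest member, $\widetilde{\mathbf b}=(a_1,\dots,a_N,\dots,a_1,\dots,a_{N-1},1+a_N,0,\dots,0)$,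 of length $\max(s,N)$ and with $\max(s,N)\bmod N$ final zeros. Blocks are ordered by $\mathbf b\mapsto\mathbf b\cdot\widehat H$ (equivalently, for blocks of the same length occurring in expansions, lexicographically). **Continuations.** A *uniform continuation* of $H$ is a continuous, strictly increasing function $h:[1,\infty)\to\mathbb R$ with $h(n)=H_n$ for all $n\in\mathbb N$ such that the functions $h_n:[0,1]\to[0,1]$, $h_n(p)=\frac{h(n+p)-h(n)}{h(n+1)-h(n)}$, converge uniformly to a continuous strictly increasing function $h_\infty$. The *Benford continuation* of $H$ is $\mathfrak H(n+p)=H_n+(H_{n+1}-H_n)\frac{\psi^p-1}{\psi-1}$ for $n\in\mathbb N$, $p\in[0,1)$; $\mathfrak H_n$ and $\mathfrak H_\infty$ are defined from $\mathfrak H$ in the same way. **Continuous leading block distribution.** Let $\mathcal H^*$ be the set of infinite tuples $\mu$ of non-negative integers, not identically zero, such that $(\mu(i),\dots,\mu(k))\in\mathcal H$ for all $k\ge i$, where $i$ is the smallest index with $\mu(i)>0$, and such that no tail $(\mu(j+n))_{n\ge1}$, $j\ge0$, equals $\Theta$. A sequence $K$ of positive integers approaching $\infty$ has *continuous leading block distribution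 under $\mathcal H$-expansion* if for every $\mu\in\mathcal H^*$ with $\mu(1)>0$ the limit $\lim_{s\to\infty}\mathrm{Prob}\{n:\mathrm{LB}_s(K_n)\le\mu|s\}$ exists (the densities being required to exist for all large $s$), and the function $h_K^*$ on $[0,1]$ with $h_K^*(0)=0$, $h_K^*(1)=1$, whose value at $\frac{\mu\cdot\widehat H-1}{\psi-1}$ is this limit, is continuous and strictly increasing. **Theorem.** 1. Let $h$ be a uniform continuation of $H$. (a) There is a sequence $K$ of positive integers approaching $\infty$ such that the fractional parts $\{h^{-1}(K_n)\}$ are equidistributed; for example $K_n=\lfloor\mathfrak H(n+\mathfrak H_n^{-1}(h_n(\{n\pi\})))\rfloor$. (b) Let $K$ be any sequence of positive integers approaching $\infty$ such that $\{h^{-1}(K_n)\}$ is equidistributed. Then for all $s\ge1$ and $\mathbf b\in\mathcal H_s$ the following density exists and $$\mathrm{Prob}\{n:\mathrm{LB}_s(K_n)=\mathbf b\}=h_\infty^{-1}\big(\mathfrak H_\infty(\log_\psi(\widetilde{\mathbf b}\cdot\widehat H))\big)-h_\infty^{-1}\big(\mathfrak H_\infty(\log_\psi(\mathbf b\cdot\widehat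 H))\big)=h_\infty^{-1}\Big(\frac{\widetilde{\mathbf b}\cdot\widehat H-1}{\psi-1}\Big)-h_\infty^{-1}\Big(\frac{\mathbf b\cdot\widehat H-1}{\psi-1}\Big).$$ 2. Let $K$ have continuous leading block distribution under $\mathcal H$-expansion. Then there is a uniform continuation $h$ of $H$ such that $h_\infty^{-1}=h_K^*$ on $[0,1]$ and $\{h^{-1}(K_n)\}$ is equidistributed. -/

import Mathlib

open Filter Topology

noncomputable section

namespace GenZeckendorf

/-! All sequences and tuples are indexed from `1`; the value at index `0` of a function on `ℕ`
that represents a sequence is never used. -/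

/-- The `k`-th entry `ε(k)` of a finite tuple, `1 ≤ k ≤ len ε`. -/
def entry (ε : List ℕ) (k : ℕ) : ℕ := ε.getD (k - 1) 0

/-- `Θ(k)`: the `k`-th entry of the infinite tuple in which `L` repeats. -/
def Theta (L : List ℕ) (k : ℕ) : ℕ := L.getD ((k - 1) % L.length) 0

/-- The finite tuple `(μ(i), …, μ(k))` cut out of an infinite tuple. -/
def segment (μ : ℕ → ℕ) (i k : ℕ) : List ℕ := (List.range (k + 1 - i)).map fun r => μ (i + r)

/-- The truncation `μ|s = (μ(1), …, μ(s))` of an infinite tuple. -/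
def trunc (μ : ℕ → ℕ) (s : ℕ) : List ℕ := segment μ 1 s

/-- The recursively defined set `𝓗°`: a tuple lies in it iff it is `Θ|s` for some `s ≥ 0`, or it is
`Θ|s` followed by an entry smaller than `Θ(s+1)` and then by a member of `𝓗°`. -/
inductive InHcirc (L : List ℕ) : List ℕ → Prop
  | full (s : ℕ) : InHcirc L (trunc (Theta L) s)
  | step (s c : ℕ) (ε : List ℕ) (hc : c < Theta L (s + 1)) (hε : InHcirc L ε) :
      InHcirc L (trunc (Theta L) s ++ c :: ε)

/-- The periodic Zeckendorf collection `𝓗` with principal maximal block `L`. -/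
def collection (L : List ℕ) : Set (List ℕ) := {ε | InHcirc L ε ∧ 0 < entry ε 1}

/-- `ε * Q = ∑_{k=1}^{t} ε(k) Q_{t-k+1}`, where `t = len ε`. -/
def conv (ε : List ℕ) (Q : ℕ → ℕ) : ℕ :=
  ∑ k ∈ Finset.Icc 1 ε.length, entry ε k * Q (ε.length - k + 1)

/-- `ε · Q = ∑_{k=1}^{t} ε(k) Q_k`, where `t = len ε`. -/
def dot (ε : List ℕ) (Q : ℕ → ℝ) : ℝ :=
  ∑ k ∈ Finset.Icc 1 ε.length, (entry ε k : ℝ) * Q k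

/-- `H` is a fundamental sequence of `𝓗`: an increasing sequence of positive integers such that
every positive integer is `ε * H` for exactly one `ε ∈ 𝓗`. -/
structure IsFundamentalSequence (L : List ℕ) (H : ℕ → ℕ) : Prop where
  pos : ∀ n, 1 ≤ n → 0 < H n
  increasing : StrictMonoOn H (Set.Ici 1)
  expansion : ∀ n, 1 ≤ n → ∃! ε : List ℕ, ε ∈ collection L ∧ conv ε H = n

/-- `g(x) = x^N - ∑_{k=1}^{N-1} a_k x^{N-k} - (1 + a_N)` for `L = (a_1, …, a_N)`. -/
def charFun (L : List ℕ) (x : ℝ) : ℝ :=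
  x ^ L.length - ∑ k ∈ Finset.Icc 1 (L.length - 1), (entry L k : ℝ) * x ^ (L.length - k)
    - (1 + (entry L L.length : ℝ))

/-- `ψ`: the dominant, i.e. largest, real zero of `g`. -/
def psi (L : List ℕ) : ℝ := sSup {x : ℝ | charFun L x = 0}

/-- `Ĥ_n = θ^{n-1}` with `θ = ψ⁻¹`. -/
def Hhat (L : List ℕ) (n : ℕ) : ℝ := (psi L)⁻¹ ^ (n - 1)

/-- `μ · Ĥ = ∑_{k ≥ 1} μ(k) Ĥ_k` for an infinite tuple `μ`. -/
def dotInf (L : List ℕ) (μ : ℕ → ℕ) : ℝ := ∑' k : ℕ, (μ (k + 1) : ℝ) * Hhat L (k + 1)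

/-! ### Leading blocks -/

/-- `LB_s(n)` is defined and equal to `b`. If `s < N = len L`, the block is filled up with zeros to
length `N`; if `s ≥ N`, nothing is appended. -/
def HasLeadingBlock (L : List ℕ) (H : ℕ → ℕ) (s n : ℕ) (b : List ℕ) : Prop :=
  ∃ ε ∈ collection L, conv ε H = n ∧ s ≤ ε.length ∧
    b = ε.take s ++ List.replicate (L.length - s) 0

/-- The set `𝓗_s`. For `s ≥ N` it consists of the leading blocks of length `s` that occur in the
expansions of the positive integers; for `s < N` it consists of the leading blocks of length `N`
that occur and whose entries after the `s`-th are zero. -/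
def leadingBlocks (L : List ℕ) (H : ℕ → ℕ) (s : ℕ) : Set (List ℕ) :=
  {b | (∃ n, 1 ≤ n ∧ HasLeadingBlock L H (max s L.length) n b) ∧ ∀ j, s < j → entry b j = 0}

/-- The exclusive block `(a_1, …, a_N, …, a_1, …, a_{N-1}, 1 + a_N, 0, …, 0)` of length
`max s N` with `max s N mod N` zeros at the end. -/
def exclusiveBlock (L : List ℕ) (s : ℕ) : List ℕ :=
  trunc (Theta L) (max s L.length / L.length * L.length - 1)
    ++ (1 + entry L L.length) :: List.replicate (max s L.length % L.length) 0

open Classical in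
/-- `b̃`: the member of `𝓗_s` that follows `b`, i.e. whose first `s` entries convolve with `H` to
one more than those of `b`; the exclusive block if `b` is the largest member. -/
def succBlock (L : List ℕ) (H : ℕ → ℕ) (s : ℕ) (b : List ℕ) : List ℕ :=
  if h : ∃ c ∈ leadingBlocks L H s, conv (c.take s) H = 1 + conv (b.take s) H
  then h.choose else exclusiveBlock L s

/-! ### Densities and equidistribution -/

open Classical in
/-- `Prob {n ∈ ℕ : P n}` exists and equals `d`. -/
def HasDensity (P : ℕ → Prop) (d : ℝ) : Prop :=
  Tendsto (fun n : ℕ => (((Finset.Icc 1 n).filter P).card : ℝ) / (n : ℝ)) atTop (𝓝 d)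

/-- The fractional parts of `x_1, x_2, …` are equidistributed. -/
def FractEquidistributed (x : ℕ → ℝ) : Prop :=
  ∀ β ∈ Set.Icc (0 : ℝ) 1, HasDensity (fun n => Int.fract (x n) ≤ β) β

/-- `K` is a sequence of positive integers approaching `∞`. -/
def PosToInfinity (K : ℕ → ℕ) : Prop := (∀ n, 1 ≤ n → 0 < K n) ∧ Tendsto K atTop atTop

/-! ### Continuations -/

/-- `h_n(p) = (h(n+p) - h(n)) / (h(n+1) - h(n))`. -/
def piece (h : ℝ → ℝ) (n : ℕ) (p : ℝ) : ℝ := (h (n + p) - h n) / (h (n + 1) - h n)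

/-- `h_∞(p) = lim_n h_n(p)`. -/
def limitPiece (h : ℝ → ℝ) (p : ℝ) : ℝ := limUnder atTop fun n : ℕ => piece h n p

/-- `h : [1, ∞) → ℝ` is a uniform continuation of the sequence `H`. A continuous `h` that
interpolates an increasing sequence is invertible only if it is increasing; this makes
`h⁻¹` meaningful and each `h_n` a map from `[0, 1]` to `[0, 1]`. -/
structure IsUniformContinuation (H : ℕ → ℕ) (h : ℝ → ℝ) : Prop where
  continuousOn : ContinuousOn h (Set.Ici 1)
  increasing : StrictMonoOn h (Set.Ici 1)
  interpolates : ∀ n : ℕ, 1 ≤ n → h n = H n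
  uniform_limit : ∃ g : ℝ → ℝ, ContinuousOn g (Set.Icc 0 1) ∧ StrictMonoOn g (Set.Icc 0 1) ∧
    TendstoUniformlyOn (piece h) g atTop (Set.Icc 0 1)

/-- `h⁻¹`, the inverse of `h : [1, ∞) → ℝ`. -/
def invHalfLine (h : ℝ → ℝ) (y : ℝ) : ℝ := Function.invFunOn h (Set.Ici 1) y

/-- The inverse of a function on `[0, 1]`. -/
def invUnit (f : ℝ → ℝ) (y : ℝ) : ℝ := Function.invFunOn f (Set.Icc 0 1) y

/-- The Benford continuation of `H`. -/
def benford (L : List ℕ) (H : ℕ → ℕ) (x : ℝ) : ℝ :=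
  (H ⌊x⌋₊ : ℝ) + ((H (⌊x⌋₊ + 1) : ℝ) - H ⌊x⌋₊) * ((psi L ^ Int.fract x - 1) / (psi L - 1))

/-! ### Continuous leading block distributions -/

/-- The set `𝓗*` of `𝓗`-expressions for `(0, 1)`. -/
def infCollection (L : List ℕ) : Set (ℕ → ℕ) :=
  {μ | (∃ i, 1 ≤ i ∧ 0 < μ i ∧ (∀ j, 1 ≤ j → j < i → μ j = 0) ∧
      ∀ k, i ≤ k → segment μ i k ∈ collection L) ∧
    ∀ j : ℕ, ¬ ∀ n, 1 ≤ n → μ (j + n) = Theta L n}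

/-- `LB_s(n)` is defined and `LB_s(n) ≤ c`, where blocks are compared by `b ↦ b · Ĥ`. -/
def LeadingBlockLE (L : List ℕ) (H : ℕ → ℕ) (s n : ℕ) (c : List ℕ) : Prop :=
  ∃ b, HasLeadingBlock L H s n b ∧ dot b (Hhat L) ≤ dot c (Hhat L)

/-- For all `μ ∈ 𝓗*` with `μ(1) > 0` the limit `lim_s Prob {n : LB_s(K_n) ≤ μ|s}` exists, and `f`
is the function `h_K^*` on `[0, 1]`: `f 0 = 0`, `f 1 = 1`, and the value of `f` at
`(μ · Ĥ - 1) / (ψ - 1)` is that limit. -/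
structure IsHStar (L : List ℕ) (H K : ℕ → ℕ) (f : ℝ → ℝ) : Prop where
  zero : f 0 = 0
  one : f 1 = 1
  limit : ∀ μ ∈ infCollection L, 0 < μ 1 → ∃ d : ℕ → ℝ,
    (∀ᶠ s in atTop, HasDensity (fun n => LeadingBlockLE L H s (K n) (trunc μ s)) (d s)) ∧
    Tendsto d atTop (𝓝 (f ((dotInf L μ - 1) / (psi L - 1))))

/-- `K` has continuous leading block distribution under `𝓗`-expansion, with `h_K^* = f`. -/
structure HasContinuousLeadingBlockDistribution (L : List ℕ) (H K : ℕ → ℕ) (f : ℝ → ℝ) :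
    Prop where
  posToInfinity : PosToInfinity K
  isHStar : IsHStar L H K f
  continuousOn : ContinuousOn f (Set.Icc 0 1)
  increasing : StrictMonoOn f (Set.Icc 0 1)

end GenZeckendorf

end

open Filter Topology

noncomputable section

namespace GenZeckendorf

/-! ### Sums and evaluation of tuples -/

/-! The integers whose expansion has length `m` are exactly those in `[H_m, H_{m+1})`, and on tuples
of one length the numerical order is lexicographic. Hence, among these integers, those with leading
block `b` form an interval `[A_m, B_m)`: `A_m` is `b` padded with zeros, and `B_m` is the padded
successor block, or `H_{m+1}` if `b` is the largest (`exists_leadingBlock_interval`).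

The collection forces a linear recursion on `H` with characteristic polynomial `g`. After scaling by
powers of `θ` the recursion becomes a weighted average, so `H_{n+1} θ^n` converges to a positive
limit (`tendsto_scaled`). Thus `A_m / H_m → b · Ĥ`, and the relative position of `A_m` in `[H_m,
H_{m+1})` tends to `(b · Ĥ - 1) / (ψ - 1)`. Uniform convergence of the pieces of `h` yields
`h⁻¹(A_m) - m → h_∞⁻¹` of that number (`IsUniformContinuation.tendsto_inv`). For `K_n` in the `m`-th
interval, `K_n < A_m` means that the fractional part of `h⁻¹(K_n)` is less than `h⁻¹(A_m) - m`, so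
equidistribution against a convergent threshold gives the density. The two formulas in 1(b) agree
because `𝔥_∞(p) = (ψ^p - 1) / (ψ - 1)`.

For 1(a), the proposed `K_n` simplifies to `⌊h(n + {nπ})⌋`. Irrationality of `π` equidistributes
`{nπ}`, and rounding by less than `1` is negligible since the gaps of `H` tend to infinity
(`IsUniformContinuation.floor_sequence`).

For 2, the value of a long leading block of `K_n` approximates `K_n / H_m`. The given limits
therefore show that the relative position of `K_n` in its interval has distribution function `f =
h_K^*` (`HasContinuousLeadingBlockDistribution.hasDensity`). Interpolating `H` by rescaled copies of
`f⁻¹` gives the required `h`. -/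

theorem sum_Icc_one_eq_sum_range {M : Type*} [AddCommMonoid M] (f : ℕ → M) (n : ℕ) :
    ∑ k ∈ Finset.Icc 1 n, f k = ∑ k ∈ Finset.range n, f (k + 1) := by
  induction n with
  | zero => simp
  | succ n ih => rw [Finset.sum_Icc_succ_top (by omega), ih, Finset.sum_range_succ]

theorem conv_eq_sum_range (ε : List ℕ) (Q : ℕ → ℕ) :
    conv ε Q = ∑ k ∈ Finset.range ε.length, ε.getD k 0 * Q (ε.length - k) := by
  unfold conv
  rw [sum_Icc_one_eq_sum_range]
  refine Finset.sum_congr rfl fun k hk => ?_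
  have := Finset.mem_range.1 hk
  simp only [entry, Nat.add_sub_cancel]
  congr 2; omega

theorem dot_eq_sum_range (ε : List ℕ) (Q : ℕ → ℝ) :
    dot ε Q = ∑ k ∈ Finset.range ε.length, (ε.getD k 0 : ℝ) * Q (k + 1) := by
  unfold dot
  rw [sum_Icc_one_eq_sum_range]
  simp [entry]

theorem conv_nil (Q : ℕ → ℕ) : conv [] Q = 0 := by simp [conv]

theorem conv_cons (c : ℕ) (u : List ℕ) (Q : ℕ → ℕ) :
    conv (c :: u) Q = c * Q (u.length + 1) + conv u Q := by
  rw [conv_eq_sum_range, conv_eq_sum_range, List.length_cons, Finset.sum_range_succ', add_comm]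
  simp

/-! ### The automaton recognising `𝓗°` -/

/-- `Admissible L j u`: the tuple `u` may follow the initial segment `Θ|j`. -/
def Admissible (L : List ℕ) : ℕ → List ℕ → Prop
  | _, [] => True
  | j, c :: u => (c = Theta L (j + 1) ∧ Admissible L (j + 1) u) ∨
      (c < Theta L (j + 1) ∧ Admissible L 0 u)

theorem length_trunc (μ : ℕ → ℕ) (s : ℕ) : (trunc μ s).length = s := by
  simp [trunc, segment]

theorem trunc_succ (μ : ℕ → ℕ) (s : ℕ) : trunc μ (s + 1) = trunc μ s ++ [μ (s + 1)] := by
  simp [trunc, segment, List.range_succ, add_comm]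

theorem trunc_zero (μ : ℕ → ℕ) : trunc μ 0 = [] := by simp [trunc, segment]

section

variable {L : List ℕ} {H : ℕ → ℕ}

theorem admissible_trunc_append (j : ℕ) (u : List ℕ) (h : Admissible L j u) :
    Admissible L 0 (trunc (Theta L) j ++ u) := by
  induction j generalizing u with
  | zero => simpa [trunc_zero] using h
  | succ j ih =>
    rw [trunc_succ, List.append_assoc]
    exact ih _ (Or.inl ⟨rfl, h⟩)

/-- The state `j` counts the entries of `Θ` matched since the last drop. An entry equal to `Θ(j+1)`
joins the matched prefix; a smaller one closes a block and resets the state to `0`. -/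
theorem inHcirc_trunc_append (u : List ℕ) (j : ℕ) (h : Admissible L j u) :
    InHcirc L (trunc (Theta L) j ++ u) := by
  induction u generalizing j with
  | nil => simpa using InHcirc.full j
  | cons c u ih =>
    rcases h with ⟨rfl, h⟩ | ⟨hc, h⟩
    · have := ih (j + 1) h
      rwa [trunc_succ, List.append_assoc] at this
    · refine InHcirc.step j c u hc ?_
      simpa [trunc_zero] using ih 0 h

theorem inHcirc_iff_admissible (u : List ℕ) : InHcirc L u ↔ Admissible L 0 u := by
  refine ⟨fun h => ?_, fun h => by simpa [trunc_zero] using inHcirc_trunc_append u 0 h⟩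
  induction h with
  | full s => simpa using admissible_trunc_append (L := L) s [] trivial
  | step s c ε hc _ ih => exact admissible_trunc_append s _ (Or.inr ⟨hc, ih⟩)

theorem mem_collection_iff (u : List ℕ) :
    u ∈ collection L ↔ Admissible L 0 u ∧ 0 < entry u 1 := by
  rw [← inHcirc_iff_admissible]; rfl

theorem Admissible.take {j : ℕ} {u : List ℕ} (h : Admissible L j u) (s : ℕ) :
    Admissible L j (u.take s) := by
  induction u generalizing j s with
  | nil => simpa using h
  | cons c u ih =>
    cases s with
    | zero => trivial
    | succ s =>
      rcases h with ⟨hc, h⟩ | ⟨hc, h⟩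
      · exact Or.inl ⟨hc, ih h s⟩
      · exact Or.inr ⟨hc, ih h s⟩

theorem admissible_replicate_zero (j k : ℕ) : Admissible L j (List.replicate k 0) := by
  induction k generalizing j with
  | zero => trivial
  | succ k ih =>
    rcases Nat.eq_zero_or_pos (Theta L (j + 1)) with h | h
    · exact Or.inl ⟨h.symm, ih _⟩
    · exact Or.inr ⟨h, ih _⟩

theorem Admissible.append_zeros {j : ℕ} {u : List ℕ} (h : Admissible L j u) (k : ℕ) :
    Admissible L j (u ++ List.replicate k 0) := by
  induction u generalizing j with
  | nil => simpa using admissible_replicate_zero j k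
  | cons c u ih =>
    rcases h with ⟨hc, h⟩ | ⟨hc, h⟩
    · exact Or.inl ⟨hc, ih h⟩
    · exact Or.inr ⟨hc, ih h⟩

theorem Theta_one (hL : 0 < entry L 1) : 0 < Theta L 1 := by
  simpa [Theta, entry] using hL

/-- Since `a_1 > 0`, a leading zero is a drop and keeps the automaton in state `0`. Tuples can
therefore be padded on the left to a common length. -/
theorem Admissible.cons_zero (hL : 0 < entry L 1) {u : List ℕ} (h : Admissible L 0 u) :
    Admissible L 0 (0 :: u) := Or.inr ⟨Theta_one hL, h⟩

theorem Admissible.zeros_append (hL : 0 < entry L 1) {u : List ℕ} (h : Admissible L 0 u) (k : ℕ) :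
    Admissible L 0 (List.replicate k 0 ++ u) := by
  induction k with
  | zero => simpa using h
  | succ k ih => exact ih.cons_zero hL

theorem conv_zeros_append (k : ℕ) (u : List ℕ) : conv (List.replicate k 0 ++ u) H = conv u H := by
  induction k with
  | zero => simp
  | succ k ih => rw [List.replicate_succ, List.cons_append, conv_cons, ih]; simp

theorem Admissible.entry_le {j : ℕ} {u : List ℕ} (h : Admissible L j u) {A : ℕ}
    (hA : ∀ k, Theta L k ≤ A) (k : ℕ) : u.getD k 0 ≤ A := by
  induction u generalizing j k with
  | nil => simp
  | cons c u ih =>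
    cases k with
    | zero =>
      have := hA (j + 1)
      rcases h with ⟨hc, -⟩ | ⟨hc, -⟩ <;> simp <;> omega
    | succ k =>
      rcases h with ⟨-, h⟩ | ⟨-, h⟩ <;> simpa using ih h k

/-! ### Values of admissible tuples -/

/-- One more than the largest value of a tuple of length `t` that may follow `Θ|j`. -/
def valueBound (L : List ℕ) (H : ℕ → ℕ) : ℕ → ℕ → ℕ
  | _, 0 => 1
  | j, t + 1 => Theta L (j + 1) * H (t + 1) + valueBound L H (j + 1) t

theorem valueBound_pos (j t : ℕ) : 0 < valueBound L H j t := by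
  induction t generalizing j with
  | zero => simp [valueBound]
  | succ t ih => have := ih (j + 1); simp only [valueBound]; omega

/-- If the first entry drops below `Θ(j+1)`, the rest restarts in state `0` and is worth less than
one unit of that entry. Only values of `H` up to index `T` are assumed known, so that the bound is
usable inside the induction that determines `H`. -/
theorem Admissible.conv_lt {T : ℕ} (hT : ∀ t < T, H (t + 1) = valueBound L H 0 t) {j : ℕ}
    {u : List ℕ} (h : Admissible L j u) (hu : u.length ≤ T) :
    conv u H < valueBound L H j u.length := by
  induction u generalizing j with
  | nil => simp [conv_nil, valueBound]
  | cons c u ih =>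
    rw [List.length_cons] at hu
    rw [conv_cons, List.length_cons, valueBound]
    rcases h with ⟨rfl, h⟩ | ⟨hc, h⟩
    · have := ih h (by omega); omega
    · have h1 := ih h (by omega)
      rw [← hT _ (by omega)] at h1
      have h2 := Nat.mul_le_mul_right (H (u.length + 1)) (Nat.succ_le_of_lt hc)
      rw [Nat.succ_mul] at h2
      omega

/-- Greedy expansion: use the full digit `Θ(j+1)` if it fits; otherwise divide by `H (t + 1)`, where
the quotient is a drop and the remainder is below the bound of state `0`. -/
theorem exists_admissible_conv_eq {T : ℕ} (hT : ∀ t < T, H (t + 1) = valueBound L H 0 t) (t : ℕ)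
    (ht : t ≤ T) (j n : ℕ) (hn : n < valueBound L H j t) :
    ∃ u, Admissible L j u ∧ u.length = t ∧ conv u H = n := by
  induction t generalizing j n with
  | zero =>
    simp only [valueBound] at hn
    exact ⟨[], trivial, rfl, by rw [conv_nil]; omega⟩
  | succ t ih =>
    rw [valueBound] at hn
    by_cases h : Theta L (j + 1) * H (t + 1) ≤ n
    · obtain ⟨u, hu, hl, hc⟩ := ih (by omega) (j + 1) (n - Theta L (j + 1) * H (t + 1)) (by omega)
      exact ⟨Theta L (j + 1) :: u, Or.inl ⟨rfl, hu⟩, by simp [hl], by rw [conv_cons, hl, hc]; omega⟩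
    · push Not at h
      have hpos : 0 < H (t + 1) := by rw [hT t (by omega)]; exact valueBound_pos _ _
      obtain ⟨u, hu, hl, hc⟩ := ih (by omega) 0 (n % H (t + 1))
        (by rw [← hT t (by omega)]; exact Nat.mod_lt _ hpos)
      refine ⟨n / H (t + 1) :: u, Or.inr ⟨(Nat.div_lt_iff_lt_mul hpos).2 h, hu⟩, by simp [hl], ?_⟩
      rw [conv_cons, hl, hc, mul_comm]
      exact Nat.div_add_mod _ _

/-- Truncation to a common length is monotone in the value. -/
theorem conv_lt_of_conv_take_lt (hT : ∀ t, H (t + 1) = valueBound L H 0 t) {j : ℕ}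
    {u v : List ℕ} (hu : Admissible L j u) (hv : Admissible L j v) (hl : u.length = v.length)
    {s : ℕ} (h : conv (u.take s) H < conv (v.take s) H) : conv u H < conv v H := by
  -- The first difference decides: the smaller entry is a drop, so what follows it cannot make up
  -- one unit.
  have key : ∀ {j c d : ℕ} {u v : List ℕ}, Admissible L j (c :: u) → Admissible L j (d :: v) →
      u.length = v.length → c < d → conv (c :: u) H < conv (d :: v) H := by
    intro j c d u v hu hv hl hcd
    have hc : c < Theta L (j + 1) := by
      rcases hv with ⟨rfl, -⟩ | ⟨hd, -⟩ <;> omega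
    have hu0 : Admissible L 0 u := by
      rcases hu with ⟨rfl, -⟩ | ⟨-, hu⟩
      · omega
      · exact hu
    have h1 := hu0.conv_lt (H := H) (T := u.length) (fun t _ => hT t) le_rfl
    rw [← hT] at h1
    have h2 := Nat.mul_le_mul_right (H (u.length + 1)) (Nat.succ_le_of_lt hcd)
    rw [Nat.succ_mul] at h2
    rw [conv_cons, conv_cons, ← hl]
    omega
  induction u generalizing j v s with
  | nil =>
    cases v with
    | nil => simp at h
    | cons => simp at hl
  | cons c u ih =>
    cases v with
    | nil => simp at hl
    | cons d v =>
      cases s with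
      | zero => simp at h
      | succ s =>
        simp only [List.length_cons, Nat.add_right_cancel_iff] at hl
        rcases lt_trichotomy c d with hcd | rfl | hcd
        · exact key hu hv hl hcd
        · have hut : (u.take s).length = (v.take s).length := by simp [hl]
          rw [List.take_succ_cons, List.take_succ_cons, conv_cons, conv_cons, hut] at h
          have h' : conv (u.take s) H < conv (v.take s) H := by omega
          rw [conv_cons, conv_cons, hl]
          have : conv u H < conv v H := by
            rcases hu with ⟨hc, hu⟩ | ⟨hc, hu⟩ <;> rcases hv with ⟨hd, hv⟩ | ⟨hd, hv⟩
            · exact ih hu hv hl h'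
            · omega
            · omega
            · exact ih hu hv hl h'
          omega
        · have := key (hv.take (s + 1)) (hu.take (s + 1)) (by simp [hl]) hcd
          rw [← List.take_succ_cons, ← List.take_succ_cons] at this
          omega

theorem Admissible.ext (hT : ∀ t, H (t + 1) = valueBound L H 0 t) {j : ℕ}
    {u v : List ℕ} (hu : Admissible L j u) (hv : Admissible L j v) (hl : u.length = v.length)
    (h : conv u H = conv v H) : u = v := by
  induction u generalizing j v with
  | nil => exact (List.length_eq_zero_iff.1 hl.symm).symm
  | cons c u ih =>
    cases v with
    | nil => simp at hl
    | cons d v =>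
      have hl' : u.length = v.length := by simpa using hl
      have hpos : 0 < H 1 := by rw [hT 0]; exact valueBound_pos _ _
      have h1 : ∀ {c d : ℕ} {u v : List ℕ}, Admissible L j (c :: u) → Admissible L j (d :: v) →
          u.length = v.length → c < d → conv (c :: u) H < conv (d :: v) H := by
        intro c d u v hu hv hl hcd
        refine conv_lt_of_conv_take_lt hT hu hv (by simp [hl]) (s := 1) ?_
        simpa [conv_cons, conv_nil] using Nat.mul_lt_mul_of_pos_right hcd hpos
      rcases lt_trichotomy c d with hcd | rfl | hcd
      · exact absurd h (h1 hu hv hl' hcd).ne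
      · rw [conv_cons, conv_cons, hl'] at h
        have h' : conv u H = conv v H := by omega
        congr 1
        rcases hu with ⟨hc, hu⟩ | ⟨hc, hu⟩ <;> rcases hv with ⟨hd, hv⟩ | ⟨hd, hv⟩
        · exact ih hu hv hl' h'
        · omega
        · omega
        · exact ih hu hv hl' h'
      · exact absurd h (h1 hv hu hl'.symm hcd).ne'

/-! ### The fundamental sequence -/

theorem exists_strip_zeros (u : List ℕ) (h : 0 < conv u H) :
    ∃ k v, u = List.replicate k 0 ++ v ∧ 0 < entry v 1 := by
  induction u with
  | nil => simp [conv_nil] at h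
  | cons c u ih =>
    rcases Nat.eq_zero_or_pos c with rfl | hc
    · rw [conv_cons] at h
      obtain ⟨k, v, rfl, hv⟩ := ih (by omega)
      exact ⟨k + 1, v, rfl, hv⟩
    · exact ⟨0, c :: u, rfl, by simpa [entry] using hc⟩

theorem Admissible.of_zeros_append (hL : 0 < entry L 1) (k : ℕ) {v : List ℕ}
    (h : Admissible L 0 (List.replicate k 0 ++ v)) : Admissible L 0 v := by
  induction k with
  | zero => simpa using h
  | succ k ih =>
    have := Theta_one hL
    rcases h with ⟨hc, -⟩ | ⟨-, h⟩
    · exact absurd hc.symm (by simpa using this.ne')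
    · exact ih h

theorem le_conv_of_entry_pos {u : List ℕ} (hu : 0 < entry u 1) :
    H u.length ≤ conv u H := by
  cases u with
  | nil => simp [entry] at hu
  | cons c u =>
    have : 0 < c := by simpa [entry] using hu
    rw [conv_cons, List.length_cons]
    nlinarith [Nat.zero_le (H (u.length + 1)), Nat.zero_le (conv u H)]

theorem conv_replicate_zero (k : ℕ) : conv (List.replicate k 0) H = 0 := by
  simpa [conv_nil] using conv_zeros_append (H := H) k []

theorem one_zeros_mem_collection (hL : 0 < entry L 1) (k : ℕ) :
    1 :: List.replicate k 0 ∈ collection L := by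
  rw [mem_collection_iff]
  refine ⟨?_, by simp [entry]⟩
  rcases (Nat.succ_le_of_lt (Theta_one hL)).eq_or_lt with h | h
  · exact Or.inl ⟨h, admissible_replicate_zero _ _⟩
  · exact Or.inr ⟨h, admissible_replicate_zero _ _⟩

/-- No admissible tuple of length at most `t` reaches the bound, so its expansion is longer and has
value at least `H (t + 1)`. Conversely, if `H (t + 1)` were below the bound, a tuple of length `t`
would represent it, contradicting uniqueness of the expansion `(1, 0, …, 0)` of length `t + 1`. -/
theorem IsFundamentalSequence.eq_valueBound (hL : 0 < entry L 1) (hH : IsFundamentalSequence L H)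
    (t : ℕ) : H (t + 1) = valueBound L H 0 t := by
  induction t using Nat.strong_induction_on with
  | _ t ih =>
    apply le_antisymm
    · obtain ⟨ε, ⟨hε, hc⟩, -⟩ := hH.expansion _ (valueBound_pos (L := L) (H := H) 0 t)
      rw [mem_collection_iff] at hε
      have hlen : t < ε.length := by
        by_contra! hlt
        have h2 := (hε.1.zeros_append hL (t - ε.length)).conv_lt ih (by simp; omega)
        rw [conv_zeros_append, hc] at h2
        simp [Nat.sub_add_cancel hlt] at h2
      calc H (t + 1) ≤ H ε.length :=
            hH.increasing.monotoneOn (by simp) (by simp; omega) (by omega)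
        _ ≤ conv ε H := le_conv_of_entry_pos hε.2
        _ = _ := hc
    · by_contra! hlt
      obtain ⟨u, hu, hl, hc⟩ := exists_admissible_conv_eq ih t le_rfl 0 _ hlt
      have hpos := hH.pos (t + 1) (by omega)
      obtain ⟨k, v, rfl, hv⟩ := exists_strip_zeros (H := H) u (by omega)
      rw [conv_zeros_append] at hc
      obtain ⟨w, -, hw⟩ := hH.expansion (H (t + 1)) hpos
      have h1 := hw v ⟨(mem_collection_iff _).2 ⟨hu.of_zeros_append hL, hv⟩, hc⟩
      have h2 := hw (1 :: List.replicate t 0) ⟨one_zeros_mem_collection hL t, by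
        simp [conv_cons, conv_replicate_zero]⟩
      have h3 := congrArg List.length (h1.trans h2.symm)
      simp at h3 hl
      omega

theorem Theta_add_length (k : ℕ) : Theta L (k + 1 + L.length) = Theta L (k + 1) := by
  simp [Theta, show k + 1 + L.length - 1 = k + L.length by omega]

theorem Theta_eq_entry {k : ℕ} (hk : k < L.length) : Theta L (k + 1) = entry L (k + 1) := by
  simp [Theta, entry, Nat.mod_eq_of_lt hk]

theorem valueBound_add_length (j t : ℕ) :
    valueBound L H (j + L.length) t = valueBound L H j t := by
  induction t generalizing j with
  | zero => rfl
  | succ t ih =>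
    rw [valueBound, valueBound, show j + L.length + 1 = j + 1 + L.length by omega,
      Theta_add_length, ih]

theorem valueBound_eq_sum (j n t : ℕ) :
    valueBound L H j (t + n) =
      ∑ k ∈ Finset.range n, Theta L (j + k + 1) * H (t + n - k) + valueBound L H (j + n) t := by
  induction n generalizing j with
  | zero => simp
  | succ n ih =>
    rw [show t + (n + 1) = t + n + 1 by omega, valueBound, ih (j + 1), Finset.sum_range_succ']
    rw [show j + (n + 1) = j + 1 + n by omega]
    have : ∀ k, Theta L (j + (k + 1) + 1) * H (t + n + 1 - (k + 1)) =
        Theta L (j + 1 + k + 1) * H (t + n - k) := fun k => by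
      congr 2 <;> omega
    simp only [this, Nat.add_zero, Nat.sub_zero]
    omega

/-- Unrolling `valueBound` over one period of `Θ` returns to the starting state, and the remaining
bound is again a term of `H`. This extra term accounts for the `1` in the constant `1 + a_N` of `g`.
-/
theorem IsFundamentalSequence.recursion (hL : 0 < entry L 1) (hH : IsFundamentalSequence L H)
    (t : ℕ) : H (t + L.length + 1) =
      ∑ k ∈ Finset.range L.length, entry L (k + 1) * H (t + L.length - k) + H (t + 1) := by
  rw [hH.eq_valueBound hL (t + L.length), valueBound_eq_sum, valueBound_add_length,
    ← hH.eq_valueBound hL t]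
  congr 1
  refine Finset.sum_congr rfl fun k hk => ?_
  rw [Nat.zero_add, Theta_eq_entry (Finset.mem_range.1 hk)]

end

section

variable {L : List ℕ} {H : ℕ → ℕ}

/-! ### Sequences of weighted averages -/

theorem weighted_average_bounds {N : ℕ} {w u : ℕ → ℝ}
    (hw : ∀ k, 0 ≤ w k) (hsum : ∑ k ∈ Finset.range N, w k = 1)
    (hu : ∀ t, u (t + N) = ∑ k ∈ Finset.range N, w k * u (t + N - 1 - k)) {t : ℕ} {a : ℝ}
    (h : ∀ i < N, a ≤ u (t + i)) (i : ℕ) : a ≤ u (t + i) := by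
  induction i using Nat.strong_induction_on with
  | _ i ih =>
    by_cases hi : i < N
    · exact h i hi
    · obtain ⟨r, rfl⟩ := Nat.exists_eq_add_of_le (not_lt.1 hi)
      rw [show t + (N + r) = t + r + N by omega, hu, ← one_mul a, ← hsum, Finset.sum_mul]
      refine Finset.sum_le_sum fun k hk => mul_le_mul_of_nonneg_left ?_ (hw k)
      have hk := Finset.mem_range.1 hk
      rw [show t + r + N - 1 - k = t + (r + N - 1 - k) by omega]
      exact ih _ (by omega)

theorem weighted_average_bounds_above {N : ℕ} {w u : ℕ → ℝ}
    (hw : ∀ k, 0 ≤ w k) (hsum : ∑ k ∈ Finset.range N, w k = 1)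
    (hu : ∀ t, u (t + N) = ∑ k ∈ Finset.range N, w k * u (t + N - 1 - k)) {t : ℕ} {b : ℝ}
    (h : ∀ i < N, u (t + i) ≤ b) (i : ℕ) : u (t + i) ≤ b :=
  neg_le_neg_iff.1 (weighted_average_bounds (u := fun n => -u n) hw hsum
    (fun t => by simp [hu t]) (fun i hi => neg_le_neg (h i hi)) i)

/-- The weight `w 0` belongs to the immediate predecessor, so each term inherits at least the
fraction `w 0` of its predecessor's excess over `a`; all other contributions are at least `a`. -/
theorem weighted_average_lift {N : ℕ} (hN : 0 < N) {w u : ℕ → ℝ}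
    (hw : ∀ k, 0 ≤ w k) (hsum : ∑ k ∈ Finset.range N, w k = 1)
    (hu : ∀ t, u (t + N) = ∑ k ∈ Finset.range N, w k * u (t + N - 1 - k)) {t : ℕ} {a c : ℝ}
    (h : ∀ i < N, a ≤ u (t + i)) (hlast : a + c ≤ u (t + N - 1)) (i : ℕ) :
    a + w 0 ^ i * c ≤ u (t + N - 1 + i) := by
  induction i with
  | zero => simpa using hlast
  | succ i ih =>
    obtain ⟨M, rfl⟩ : ∃ M, N = M + 1 := ⟨N - 1, by omega⟩
    rw [show t + (M + 1) - 1 + (i + 1) = t + i + (M + 1) by omega, hu, Finset.sum_range_succ']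
    rw [Finset.sum_range_succ'] at hsum
    have h1 : ∑ k ∈ Finset.range M, w (k + 1) * a ≤
        ∑ k ∈ Finset.range M, w (k + 1) * u (t + i + (M + 1) - 1 - (k + 1)) := by
      refine Finset.sum_le_sum fun k hk => mul_le_mul_of_nonneg_left ?_ (hw _)
      have hk := Finset.mem_range.1 hk
      rw [show t + i + (M + 1) - 1 - (k + 1) = t + (i + M - (k + 1)) by omega]
      exact weighted_average_bounds hw (by rwa [Finset.sum_range_succ']) hu h _
    rw [← Finset.sum_mul, show ∑ k ∈ Finset.range M, w (k + 1) = 1 - w 0 by linarith] at h1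
    have h2 := mul_le_mul_of_nonneg_left ih (hw 0)
    rw [show t + (M + 1) - 1 + i = t + i + (M + 1) - 1 - 0 by omega] at h2
    rw [pow_succ]
    nlinarith

/-- The last term of a window lies in the upper or the lower half of `[a, b]`. Its excess over the
far end is at least `(b - a) / 2` and, up to the factor `w 0 ^ N`, survives throughout the next
window. -/
theorem weighted_average_contract {N : ℕ} (hN : 0 < N) {w u : ℕ → ℝ}
    (hw : ∀ k, 0 ≤ w k) (hsum : ∑ k ∈ Finset.range N, w k = 1)
    (hu : ∀ t, u (t + N) = ∑ k ∈ Finset.range N, w k * u (t + N - 1 - k)) {t : ℕ} {a b : ℝ}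
    (ha : ∀ i < N, a ≤ u (t + i)) (hb : ∀ i < N, u (t + i) ≤ b) :
    ∃ a' b', (∀ i < N, a' ≤ u (t + N + i)) ∧ (∀ i < N, u (t + N + i) ≤ b') ∧
      b' - a' = (1 - w 0 ^ N / 2) * (b - a) := by
  have hab : a ≤ b := (ha 0 hN).trans (hb 0 hN)
  have hw1 : w 0 ≤ 1 := by
    rw [← hsum]
    exact Finset.single_le_sum (f := w) (fun k _ => hw k) (Finset.mem_range.2 hN)
  have hnb : ∀ i < N, -b ≤ (fun n => -u n) (t + i) := fun i hi => neg_le_neg (hb i hi)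
  have hnu : ∀ t, (fun n => -u n) (t + N) =
      ∑ k ∈ Finset.range N, w k * (fun n => -u n) (t + N - 1 - k) := fun t => by
    simp [hu t]
  have hA : ∀ i, a ≤ u (t + i) := weighted_average_bounds hw hsum hu ha
  have hB : ∀ i, u (t + i) ≤ b := 
    weighted_average_bounds_above hw hsum hu hb
  have hpow : ∀ i < N, w 0 ^ N ≤ w 0 ^ (i + 1) := fun i hi =>
    pow_le_pow_of_le_one (hw 0) hw1 (by omega)
  rcases le_total ((a + b) / 2) (u (t + N - 1)) with h | h
  · refine ⟨a + w 0 ^ N * ((b - a) / 2), b, fun i hi => ?_, fun i _ => ?_, by ring⟩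
    · have := weighted_average_lift hN hw hsum hu ha (c := (b - a) / 2) (by linarith)
        (i + 1)
      rw [show t + N - 1 + (i + 1) = t + N + i by omega] at this
      nlinarith [hpow i hi]
    · rw [add_assoc]; exact hB _
  · refine ⟨a, b - w 0 ^ N * ((b - a) / 2), fun i _ => ?_, fun i hi => ?_, by ring⟩
    · rw [add_assoc]; exact hA _
    · have := weighted_average_lift (u := fun n => -u n) hN hw hsum hnu hnb (c := (b - a) / 2) (by linarith)
        (i + 1)
      rw [show t + N - 1 + (i + 1) = t + N + i by omega] at this
      nlinarith [hpow i hi]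

/-- The oscillation over consecutive windows shrinks geometrically, so the sequence is Cauchy. Its
limit is positive because the minimum over the first window bounds every term from below. -/
theorem weighted_average_tendsto {N : ℕ} (hN : 0 < N) {w u : ℕ → ℝ}
    (hw : ∀ k, 0 ≤ w k) (hw0 : 0 < w 0) (hsum : ∑ k ∈ Finset.range N, w k = 1)
    (hu : ∀ t, u (t + N) = ∑ k ∈ Finset.range N, w k * u (t + N - 1 - k))
    (hpos : ∀ t, 0 < u t) : ∃ c, 0 < c ∧ Tendsto u atTop (𝓝 c) := by
  obtain ⟨i₀, -, hi₀⟩ := Finset.exists_min_image (Finset.range N) u ⟨0, Finset.mem_range.2 hN⟩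
  obtain ⟨i₁, -, hi₁⟩ := Finset.exists_max_image (Finset.range N) u ⟨0, Finset.mem_range.2 hN⟩
  have hw1 : w 0 ≤ 1 := by
    rw [← hsum]
    exact Finset.single_le_sum (f := w) (fun k _ => hw k) (Finset.mem_range.2 hN)
  have hδ0 : 0 < w 0 ^ N := pow_pos hw0 N
  have hδ1 : w 0 ^ N ≤ 1 := pow_le_one₀ hw0.le hw1
  have hlow : ∀ n, u i₀ ≤ u n := fun n => by
    simpa using weighted_average_bounds hw hsum hu (t := 0) (a := u i₀)
      (fun i hi => by simpa using hi₀ i (Finset.mem_range.2 hi)) n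
  have hnest : ∀ k : ℕ, ∃ a b, (∀ i < N, a ≤ u (k * N + i)) ∧ (∀ i < N, u (k * N + i) ≤ b) ∧
      b - a = (1 - w 0 ^ N / 2) ^ k * (u i₁ - u i₀) := by
    intro k
    induction k with
    | zero =>
      exact ⟨u i₀, u i₁, fun i hi => by simpa using hi₀ i (Finset.mem_range.2 hi),
        fun i hi => by simpa using hi₁ i (Finset.mem_range.2 hi), by simp⟩
    | succ k ih =>
      obtain ⟨a, b, ha, hb, hd⟩ := ih
      obtain ⟨a', b', ha', hb', hd'⟩ := weighted_average_contract hN hw hsum hu ha hb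
      refine ⟨a', b', ?_, ?_, ?_⟩
      · simpa [Nat.succ_mul] using ha'
      · simpa [Nat.succ_mul] using hb'
      · rw [hd', hd]; ring
  have hcauchy : CauchySeq u := by
    rw [Metric.cauchySeq_iff']
    intro ε hε
    have hlim : Tendsto (fun k : ℕ => (1 - w 0 ^ N / 2) ^ k * (u i₁ - u i₀)) atTop (𝓝 0) := by
      simpa using (tendsto_pow_atTop_nhds_zero_of_lt_one (r := 1 - w 0 ^ N / 2)
        (by linarith) (by linarith)).mul_const (u i₁ - u i₀)
    obtain ⟨k, hk⟩ := ((tendsto_order.1 hlim).2 ε hε).exists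
    obtain ⟨a, b, ha, hb, hd⟩ := hnest k
    refine ⟨k * N, fun n hn => ?_⟩
    obtain ⟨r, rfl⟩ := Nat.exists_eq_add_of_le hn
    have h1 := weighted_average_bounds hw hsum hu ha r
    have h2 := weighted_average_bounds_above hw hsum hu hb r
    have h3 := ha 0 hN
    have h4 := hb 0 hN
    rw [Nat.add_zero] at h3 h4
    rw [Real.dist_eq, abs_lt]
    constructor <;> linarith
  obtain ⟨c, hc⟩ := cauchySeq_tendsto_of_complete hcauchy
  exact ⟨c, (hpos i₀).trans_le (ge_of_tendsto' hc hlow), hc⟩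

/-! ### The dominant zero -/

theorem charFun_eq (hN : 2 ≤ L.length) (x : ℝ) : charFun L x =
    x ^ L.length - ∑ k ∈ Finset.range L.length, (entry L (k + 1) : ℝ) * x ^ (L.length - 1 - k)
      - 1 := by
  obtain ⟨M, hM⟩ : ∃ M, L.length = M + 1 := ⟨L.length - 1, by omega⟩
  rw [charFun, hM, Nat.add_sub_cancel, sum_Icc_one_eq_sum_range, Finset.sum_range_succ]
  have : ∀ k, M + 1 - (k + 1) = M - k := fun k => by omega
  simp [this]
  ring

/-- `∑ a_k y^k + y^N`, which equals `1` exactly at the inverses of the positive zeros of `g`. -/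
def weightFun (L : List ℕ) (y : ℝ) : ℝ :=
  ∑ k ∈ Finset.range L.length, (entry L (k + 1) : ℝ) * y ^ (k + 1) + y ^ L.length

theorem weightFun_inv (hN : 2 ≤ L.length) {x : ℝ} (hx : 0 < x) :
    charFun L x = x ^ L.length * (1 - weightFun L x⁻¹) := by
  rw [charFun_eq hN, weightFun, mul_sub, mul_add, mul_one, Finset.mul_sum, inv_pow,
    mul_inv_cancel₀ (by positivity), sub_sub]
  congr 2
  refine Finset.sum_congr rfl fun k hk => ?_
  have hk := Finset.mem_range.1 hk
  rw [inv_pow, show L.length = L.length - 1 - k + (k + 1) by omega, pow_add,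
    show L.length - 1 - k + (k + 1) - 1 - k = L.length - 1 - k by omega]
  field_simp

theorem weightFun_lt (hN : 2 ≤ L.length) {y z : ℝ} (hy : 0 ≤ y) (hyz : y < z) :
    weightFun L y < weightFun L z := by
  refine add_lt_add_of_le_of_lt (Finset.sum_le_sum fun k _ => ?_)
    (pow_lt_pow_left₀ hyz hy (by omega))
  gcongr

theorem exists_charFun_eq_zero (hN : 2 ≤ L.length) (hL : 0 < entry L 1) :
    ∃ x, 1 < x ∧ charFun L x = 0 := by
  -- Here `g(1) = -S < 0`, while at `S + 1` the leading power beats the sum, which is at most `S (S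
  -- + 1)^(N-1)`, by at least `1`.
  set S : ℝ := ∑ k ∈ Finset.range L.length, (entry L (k + 1) : ℝ) with hS
  have hS1 : 1 ≤ S := by
    refine le_trans ?_ (Finset.single_le_sum (f := fun k => (entry L (k + 1) : ℝ))
      (fun k _ => Nat.cast_nonneg _) (Finset.mem_range.2 (show 0 < L.length by omega)))
    simpa using Nat.succ_le_of_lt hL
  have h1 : charFun L 1 < 0 := by
    rw [charFun_eq hN]; simp [← hS]; linarith
  have h2 : 0 ≤ charFun L (S + 1) := by
    rw [charFun_eq hN]
    have h3 : ∑ k ∈ Finset.range L.length, (entry L (k + 1) : ℝ) * (S + 1) ^ (L.length - 1 - k)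
        ≤ S * (S + 1) ^ (L.length - 1) := by
      rw [hS, Finset.sum_mul, ← hS]
      refine Finset.sum_le_sum fun k _ => mul_le_mul_of_nonneg_left ?_ (Nat.cast_nonneg _)
      exact pow_le_pow_right₀ (by linarith) (by omega)
    have h4 : (S + 1) ^ L.length = (S + 1) * (S + 1) ^ (L.length - 1) := by
      rw [← pow_succ', Nat.sub_add_cancel (by omega)]
    have h5 : 1 ≤ (S + 1) ^ (L.length - 1) := one_le_pow₀ (by linarith)
    rw [h4]
    linarith
  have hcont : Continuous (charFun L) := by unfold charFun; fun_prop
  obtain ⟨x, hx, hx0⟩ := intermediate_value_Icc (show (1 : ℝ) ≤ S + 1 by linarith)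
    hcont.continuousOn ⟨h1.le, h2⟩
  refine ⟨x, lt_of_le_of_ne hx.1 ?_, hx0⟩
  rintro rfl
  exact h1.ne hx0

/-- Strict monotonicity of `weightFun` on `[0, ∞)` leaves room for only one positive zero of `g`, so
the supremum defining `psi` is attained there. -/
theorem psi_spec (hN : 2 ≤ L.length) (hL : 0 < entry L 1) : 1 < psi L ∧ charFun L (psi L) = 0 := by
  obtain ⟨x, hx1, hx⟩ := exists_charFun_eq_zero hN hL
  have hroot : ∀ y, 0 < y → charFun L y = 0 → weightFun L y⁻¹ = 1 := fun y hy h => by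
    rw [weightFun_inv hN hy] at h
    have := (mul_eq_zero.1 h).resolve_left (by positivity)
    linarith
  have : psi L = x := by
    refine IsGreatest.csSup_eq ⟨hx, fun y hy => ?_⟩
    by_contra! hlt
    have h := weightFun_lt (L := L) hN (inv_nonneg.2 (by linarith)) (inv_strictAnti₀ (by linarith) hlt)
    rw [hroot x (by linarith) hx, hroot y (by linarith) hy] at h
    exact lt_irrefl _ h
  rw [this]
  exact ⟨hx1, hx⟩

theorem weightFun_inv_psi (hN : 2 ≤ L.length) (hL : 0 < entry L 1) :
    weightFun L (psi L)⁻¹ = 1 := by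
  obtain ⟨h1, h⟩ := psi_spec hN hL
  rw [weightFun_inv hN (by linarith)] at h
  have := (mul_eq_zero.1 h).resolve_left (by positivity)
  linarith

/-! ### Growth of the fundamental sequence -/

/-- Scaling turns the recursion into an average with weights `a_k θ^k`, the last one increased by
`θ^N`. They sum to `1` because `g(ψ) = 0`, and the weight of the predecessor is positive because
`a_1 > 0`. -/
theorem tendsto_scaled (hN : 2 ≤ L.length) (hL : 0 < entry L 1)
    (hH : IsFundamentalSequence L H) :
    ∃ c, 0 < c ∧ Tendsto (fun n => (H (n + 1) : ℝ) * (psi L)⁻¹ ^ n) atTop (𝓝 c) := by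
  obtain ⟨hψ, -⟩ := psi_spec hN hL
  set θ := (psi L)⁻¹ with hθ
  have hθ0 : 0 < θ := inv_pos.2 (by linarith)
  obtain ⟨M, hM⟩ : ∃ M, L.length = M + 1 := ⟨L.length - 1, by omega⟩
  have hw1 := weightFun_inv_psi hN hL
  rw [← hθ, weightFun, hM] at hw1
  refine weighted_average_tendsto (N := L.length)
    (w := fun k => (entry L (k + 1) : ℝ) * θ ^ (k + 1) + if k = M then θ ^ (M + 1) else 0)
    (by omega) (fun k => ?_) ?_ ?_ (fun t => ?_) (fun t => ?_)
  · have : 0 ≤ θ ^ (M + 1) := by positivity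
    split_ifs <;> positivity
  · have : 0 < (entry L 1 : ℝ) := by exact_mod_cast hL
    have : 0 ≤ θ ^ (M + 1) := by positivity
    split_ifs <;> positivity
  · rw [Finset.sum_add_distrib, hM]
    simpa using hw1
  · have hrec := hH.recursion hL t
    rw [hrec, hM]
    simp only [add_mul, Finset.sum_add_distrib, ite_mul, zero_mul, Finset.sum_ite_eq',
      Finset.mem_range, Nat.lt_succ_self, if_true]
    push_cast
    rw [add_mul, Finset.sum_mul]
    congr 1
    · refine Finset.sum_congr rfl fun k hk => ?_
      have hk := Finset.mem_range.1 hk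
      rw [show t + (M + 1) - 1 - k + 1 = t + (M + 1) - k by omega,
        show t + (M + 1) = (t + (M + 1) - 1 - k) + (k + 1) by omega, pow_add,
        show t + (M + 1) - 1 - k + (k + 1) - 1 - k = t + (M + 1) - 1 - k by omega]
      ring
    · rw [show t + (M + 1) - 1 - M = t by omega, pow_add]
      ring
  · have := hH.pos (t + 1) (by omega)
    positivity

theorem tendsto_ratio (hN : 2 ≤ L.length) (hL : 0 < entry L 1)
    (hH : IsFundamentalSequence L H) (k : ℕ) :
    Tendsto (fun m => (H (m - k) : ℝ) / H m) atTop (𝓝 ((psi L)⁻¹ ^ k)) := by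
  obtain ⟨c, hc, hlim⟩ := tendsto_scaled hN hL hH
  obtain ⟨hψ, -⟩ := psi_spec hN hL
  set θ := (psi L)⁻¹ with hθ
  have hθ0 : 0 < θ := inv_pos.2 (by linarith)
  rw [← tendsto_add_atTop_iff_nat (k + 1)]
  have h1 := (hlim.div (hlim.comp (tendsto_add_atTop_nat k)) hc.ne').mul_const (θ ^ k)
  rw [div_self hc.ne', one_mul] at h1
  refine h1.congr fun n => ?_
  have h2 := hH.pos (n + k + 1) (by omega)
  have h3 : (0 : ℝ) < H (n + k + 1) := by exact_mod_cast h2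
  simp only [Pi.div_apply, Function.comp]
  rw [show n + (k + 1) - k = n + 1 by omega, show n + (k + 1) = n + k + 1 by omega, pow_add]
  field_simp

/-- The scaled sequence and its reciprocal are both bounded. Unlike `tendsto_ratio`, this is uniform
in `k` and so controls the tails of sums. -/
theorem exists_ratio_le (hN : 2 ≤ L.length) (hL : 0 < entry L 1)
    (hH : IsFundamentalSequence L H) :
    ∃ C : ℝ, 0 < C ∧ ∀ k m, k < m → (H (m - k) : ℝ) / H m ≤ C * (psi L)⁻¹ ^ k := by
  obtain ⟨c, hc, hlim⟩ := tendsto_scaled hN hL hH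
  obtain ⟨hψ, -⟩ := psi_spec hN hL
  set θ := (psi L)⁻¹ with hθ
  have hθ0 : 0 < θ := inv_pos.2 (by linarith)
  have hpos : ∀ n, 0 < (H (n + 1) : ℝ) * θ ^ n := fun n => by
    have := hH.pos (n + 1) (by omega)
    positivity
  obtain ⟨B, hB⟩ := hlim.bddAbove_range
  obtain ⟨B', hB'⟩ := (hlim.inv₀ hc.ne').bddAbove_range
  have hB0 : 0 < B := (hpos 0).trans_le (hB ⟨0, rfl⟩)
  have hB0' : 0 < B' := (inv_pos.2 (hpos 0)).trans_le (hB' ⟨0, rfl⟩)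
  refine ⟨B * B', by positivity, fun k m hkm => ?_⟩
  obtain ⟨r, rfl⟩ : ∃ r, m = r + k + 1 := ⟨m - k - 1, by omega⟩
  have h1 : (H (r + 1) : ℝ) * θ ^ r ≤ B := hB ⟨r, rfl⟩
  have h2 : ((H (r + k + 1) : ℝ) * θ ^ (r + k))⁻¹ ≤ B' := hB' ⟨r + k, rfl⟩
  have h3 := mul_le_mul h1 h2 (inv_pos.2 (hpos _)).le hB0.le
  have h4 : (0 : ℝ) < H (r + k + 1) := by exact_mod_cast hH.pos (r + k + 1) (by omega)
  rw [show r + k + 1 - k = r + 1 by omega]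
  calc (H (r + 1) : ℝ) / H (r + k + 1)
      = ((H (r + 1) : ℝ) * θ ^ r * ((H (r + k + 1) : ℝ) * θ ^ (r + k))⁻¹) * θ ^ k := by
        rw [pow_add]; field_simp
    _ ≤ B * B' * θ ^ k := by gcongr

theorem tendsto_succ_ratio (hN : 2 ≤ L.length) (hL : 0 < entry L 1)
    (hH : IsFundamentalSequence L H) :
    Tendsto (fun m => (H (m + 1) : ℝ) / H m) atTop (𝓝 (psi L)) := by
  obtain ⟨hψ, -⟩ := psi_spec hN hL
  have h := ((tendsto_ratio hN hL hH 1).comp (tendsto_add_atTop_nat 1)).inv₀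
    (pow_ne_zero 1 (inv_ne_zero (by linarith)))
  simpa using h

/-! ### Blocks in the limit -/

theorem Hhat_succ (k : ℕ) : Hhat L (k + 1) = (psi L)⁻¹ ^ k := by simp [Hhat]

theorem dot_nil (Q : ℕ → ℝ) : dot [] Q = 0 := by simp [dot]

theorem dot_cons (c : ℕ) (u : List ℕ) :
    dot (c :: u) (Hhat L) = c + (psi L)⁻¹ * dot u (Hhat L) := by
  rw [dot_eq_sum_range, dot_eq_sum_range, List.length_cons, Finset.sum_range_succ', add_comm,
    Finset.mul_sum]
  simp only [Hhat_succ, pow_zero, mul_one, List.getD_cons_zero, List.getD_cons_succ]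
  congr 1
  refine Finset.sum_congr rfl fun k _ => ?_
  rw [pow_succ]; ring

theorem dot_append (u v : List ℕ) :
    dot (u ++ v) (Hhat L) = dot u (Hhat L) + (psi L)⁻¹ ^ u.length * dot v (Hhat L) := by
  induction u with
  | nil => simp [dot_nil]
  | cons c u ih => rw [List.cons_append, dot_cons, dot_cons, ih, List.length_cons, pow_succ]; ring

theorem dot_replicate_zero (k : ℕ) : dot (List.replicate k 0) (Hhat L) = 0 := by
  induction k with
  | zero => simp [dot_nil]
  | succ k ih => rw [List.replicate_succ, dot_cons, ih]; simp

theorem dot_append_zeros (u : List ℕ) (k : ℕ) :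
    dot (u ++ List.replicate k 0) (Hhat L) = dot u (Hhat L) := by
  rw [dot_append, dot_replicate_zero]; simp

theorem getD_trunc (μ : ℕ → ℕ) {s k : ℕ} (hk : k < s) : (trunc μ s).getD k 0 = μ (k + 1) := by
  rw [List.getD_eq_getElem _ _ (by simpa [length_trunc] using hk)]
  simp [trunc, segment, add_comm]

theorem dot_trunc (μ : ℕ → ℕ) (s : ℕ) :
    dot (trunc μ s) (Hhat L) = ∑ k ∈ Finset.range s, (μ (k + 1) : ℝ) * (psi L)⁻¹ ^ k := by
  rw [dot_eq_sum_range, length_trunc]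
  refine Finset.sum_congr rfl fun k hk => ?_
  rw [getD_trunc μ (Finset.mem_range.1 hk), Hhat_succ]

/-- By `weightFun L θ = 1`, one period of `Θ` contributes `1 - θ^N`; the sum over periods
telescopes. -/
theorem dot_trunc_Theta_mul_length (hN : 2 ≤ L.length) (hL : 0 < entry L 1) (q : ℕ) :
    (psi L)⁻¹ * dot (trunc (Theta L) (q * L.length)) (Hhat L) =
      1 - (psi L)⁻¹ ^ (q * L.length) := by
  have hw := weightFun_inv_psi hN hL
  rw [weightFun] at hw
  rw [dot_trunc]
  induction q with
  | zero => simp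
  | succ q ih =>
    rw [Nat.succ_mul, Finset.sum_range_add, mul_add, ih]
    have hTh : ∀ k < L.length, Theta L (q * L.length + k + 1) = entry L (k + 1) := by
      intro k hk
      simp [Theta, entry, Nat.mul_comm q, Nat.mod_eq_of_lt hk]
    have : ∑ k ∈ Finset.range L.length,
        (Theta L (q * L.length + k + 1) : ℝ) * (psi L)⁻¹ ^ (q * L.length + k) * (psi L)⁻¹ =
        (psi L)⁻¹ ^ (q * L.length) *
          ∑ k ∈ Finset.range L.length, (entry L (k + 1) : ℝ) * (psi L)⁻¹ ^ (k + 1) := by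
      rw [Finset.mul_sum]
      refine Finset.sum_congr rfl fun k hk => ?_
      rw [hTh k (Finset.mem_range.1 hk)]
      ring
    rw [mul_comm (psi L)⁻¹, Finset.sum_mul, this, pow_add]
    linear_combination (psi L)⁻¹ ^ (q * L.length) * hw

/-- The extra unit in the last nonzero position supplies exactly the missing `θ^(qN)` after
multiplication by `θ`. This matches `H_{m+1} / H_m → ψ`, the upper end for the largest block. -/
theorem dot_exclusiveBlock (hN : 2 ≤ L.length) (hL : 0 < entry L 1) (s : ℕ) :
    dot (exclusiveBlock L s) (Hhat L) = psi L := by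
  obtain ⟨hψ, -⟩ := psi_spec hN hL
  set q := max s L.length / L.length with hq
  have hq1 : 1 ≤ q := (Nat.one_le_div_iff (by omega)).2 (le_max_right _ _)
  obtain ⟨M, hM⟩ : ∃ M, q * L.length = M + 1 :=
    ⟨q * L.length - 1, by have := Nat.mul_le_mul hq1 hN; omega⟩
  have hlast : Theta L (M + 1) = entry L L.length := by
    obtain ⟨p, hp⟩ : ∃ p, q = p + 1 := ⟨q - 1, by omega⟩
    have : M = L.length * p + (L.length - 1) := by
      rw [hp, Nat.succ_mul, mul_comm] at hM; omega
    simp [Theta, entry, this, Nat.mod_eq_of_lt (show L.length - 1 < L.length by omega)]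
  have h := dot_trunc_Theta_mul_length hN hL q
  rw [hM, trunc_succ, dot_append, dot_cons, dot_nil, length_trunc, hlast] at h
  rw [exclusiveBlock, ← hq, hM, Nat.add_sub_cancel, dot_append, dot_cons, dot_replicate_zero,
    length_trunc]
  have hθ : (psi L)⁻¹ ≠ 0 := inv_ne_zero (by linarith)
  apply mul_left_cancel₀ hθ
  rw [inv_mul_cancel₀ (by linarith)]
  push_cast
  rw [pow_succ] at h
  linear_combination h

/-- `∑_k ε(k) H_{m-k+1}`, the value of `ε` as the leading block of a tuple of length `m`. -/
theorem tendsto_conv_append_zeros (hN : 2 ≤ L.length) (hL : 0 < entry L 1)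
    (hH : IsFundamentalSequence L H) (u : List ℕ) :
    Tendsto (fun m => (conv (u ++ List.replicate (m - u.length) 0) H : ℝ) / H m) atTop
      (𝓝 (dot u (Hhat L))) := by
  rw [dot_eq_sum_range]
  have h : Tendsto (fun m => ∑ k ∈ Finset.range u.length, (u.getD k 0 : ℝ) *
      ((H (m - k) : ℝ) / H m)) atTop
      (𝓝 (∑ k ∈ Finset.range u.length, (u.getD k 0 : ℝ) * Hhat L (k + 1))) := by
    refine tendsto_finsetSum _ fun k _ => ?_
    rw [Hhat_succ]
    exact (tendsto_ratio hN hL hH k).const_mul _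
  refine h.congr' ?_
  filter_upwards [eventually_ge_atTop u.length] with m hm
  rw [conv_eq_sum_range, List.length_append, List.length_replicate, Nat.add_sub_cancel' hm]
  obtain ⟨r, rfl⟩ := Nat.exists_eq_add_of_le hm
  rw [Finset.sum_range_add]
  have h0 : ∑ k ∈ Finset.range r, (u ++ List.replicate (u.length + r - u.length) 0).getD
      (u.length + k) 0 * H (u.length + r - (u.length + k)) = 0 := by
    refine Finset.sum_eq_zero fun k _ => ?_
    rw [List.getD_append_right _ _ _ _ (by omega)]
    simp
  rw [h0, add_zero]
  push_cast
  rw [Finset.sum_div]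
  refine Finset.sum_congr rfl fun k hk => ?_
  rw [List.getD_append _ _ _ _ (Finset.mem_range.1 hk)]
  ring

end

/-! ### Densities -/

open Classical in
/-- The number of `k ∈ {1, …, n}` with `P k`. -/
def count (P : ℕ → Prop) (n : ℕ) : ℕ := ((Finset.Icc 1 n).filter P).card

theorem count_eq (P : ℕ → Prop) [DecidablePred P] (n : ℕ) :
    count P n = ((Finset.Icc 1 n).filter P).card := by
  unfold count; congr

theorem hasDensity_iff {P : ℕ → Prop} {d : ℝ} :
    HasDensity P d ↔ Tendsto (fun n : ℕ => (count P n : ℝ) / n) atTop (𝓝 d) := Iff.rfl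

theorem count_mono {P Q : ℕ → Prop} {n : ℕ} (h : ∀ k, 1 ≤ k → P k → Q k) :
    count P n ≤ count Q n := by
  classical
  refine Finset.card_le_card fun k hk => ?_
  simp only [Finset.mem_filter, Finset.mem_Icc] at hk ⊢
  exact ⟨hk.1, h k hk.1.1 hk.2⟩

theorem count_le_add {P Q : ℕ → Prop} {n₀ : ℕ} (h : ∀ k, n₀ ≤ k → P k → Q k) (n : ℕ) :
    count P n ≤ count Q n + n₀ := by
  classical
  calc count P n ≤ ((Finset.Icc 1 n).filter Q ∪ Finset.range n₀).card := by
        refine Finset.card_le_card fun k hk => ?_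
        simp only [Finset.mem_filter, Finset.mem_Icc, Finset.mem_union, Finset.mem_range] at hk ⊢
        by_cases hk0 : k < n₀
        · exact Or.inr hk0
        · exact Or.inl ⟨hk.1, h k (not_lt.1 hk0) hk.2⟩
    _ ≤ _ := by
        simpa [count_eq] using Finset.card_union_le ((Finset.Icc 1 n).filter Q) (Finset.range n₀)

theorem count_add_count_not (P : ℕ → Prop) (n : ℕ) : count P n + count (fun k => ¬ P k) n = n := by
  classical
  simpa [count_eq] using Finset.card_filter_add_card_filter_not (s := Finset.Icc 1 n) P

/-- A squeeze between events of known density. The inclusions may fail for finitely many `n`, which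
changes the averages by at most a constant over `n`. -/
theorem hasDensity_of_bounds {R : ℕ → Prop} {d₀ : ℝ}
    (hlow : ∀ a < d₀, ∃ (P : ℕ → Prop) (d : ℝ), a < d ∧ HasDensity P d ∧ ∀ᶠ n in atTop, P n → R n)
    (hup : ∀ a > d₀, ∃ (P : ℕ → Prop) (d : ℝ), d < a ∧ HasDensity P d ∧
      ∀ᶠ n in atTop, R n → P n) : HasDensity R d₀ := by
  have hC : ∀ C : ℕ, Tendsto (fun n : ℕ => (C : ℝ) / n) atTop (𝓝 0) := fun C =>
    tendsto_const_div_atTop_nhds_zero_nat _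
  rw [hasDensity_iff, tendsto_order]
  constructor
  · intro a ha
    obtain ⟨P, d, had, hP, hev⟩ := hlow a ha
    obtain ⟨n₀, hn₀⟩ := eventually_atTop.1 hev
    have h := (hasDensity_iff.1 hP).sub (hC n₀)
    rw [sub_zero] at h
    filter_upwards [(tendsto_order.1 h).1 a had] with n hn
    refine hn.trans_le ?_
    rw [← sub_div]
    gcongr
    have : (count P n : ℝ) ≤ count R n + n₀ := by exact_mod_cast count_le_add hn₀ n
    linarith
  · intro a ha
    obtain ⟨P, d, had, hP, hev⟩ := hup a ha
    obtain ⟨n₀, hn₀⟩ := eventually_atTop.1 hev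
    have h := (hasDensity_iff.1 hP).add (hC n₀)
    rw [add_zero] at h
    filter_upwards [(tendsto_order.1 h).2 a had] with n hn
    refine lt_of_le_of_lt ?_ hn
    rw [← add_div]
    gcongr
    exact_mod_cast count_le_add hn₀ n

theorem HasDensity.congr {P Q : ℕ → Prop} {d : ℝ} (h : HasDensity P d)
    (hev : ∀ᶠ n in atTop, P n ↔ Q n) : HasDensity Q d :=
  hasDensity_of_bounds (fun _ ha => ⟨P, d, ha, h, hev.mono fun _ hn => hn.1⟩)
    (fun _ ha => ⟨P, d, ha, h, hev.mono fun _ hn => hn.2⟩)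

theorem hasDensity_of_forall {P : ℕ → Prop} (h : ∀ n, 1 ≤ n → P n) : HasDensity P 1 := by
  rw [hasDensity_iff]
  refine tendsto_const_nhds.congr' ?_
  filter_upwards [eventually_gt_atTop 0] with n hn
  have h0 : count (fun k => ¬ P k) n = 0 := by
    classical
    rw [count_eq]
    refine Finset.card_eq_zero.2 (Finset.filter_eq_empty_iff.2 fun k hk => ?_)
    exact not_not.2 (h k (Finset.mem_Icc.1 hk).1)
  have h1 := count_add_count_not P n
  rw [h0, add_zero] at h1
  rw [h1, div_self (by positivity)]

theorem hasDensity_of_forall_not {P : ℕ → Prop} (h : ∀ n, 1 ≤ n → ¬ P n) : HasDensity P 0 := by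
  rw [hasDensity_iff]
  refine tendsto_const_nhds.congr fun n => ?_
  have h0 : count P n = 0 := by
    classical
    refine Finset.card_eq_zero.2 (Finset.filter_eq_empty_iff.2 fun k hk => ?_)
    exact h k (Finset.mem_Icc.1 hk).1
  simp [h0]

theorem HasDensity.and_not {P Q : ℕ → Prop} {d₁ d₂ : ℝ} (hP : HasDensity P d₁)
    (hQ : HasDensity Q d₂) (h : ∀ᶠ n in atTop, P n → Q n) :
    HasDensity (fun n => ¬ P n ∧ Q n) (d₂ - d₁) := by
  have hP' : HasDensity (fun n => P n ∧ Q n) d₁ :=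
    hP.congr (h.mono fun n hn => ⟨fun hp => ⟨hp, hn hp⟩, fun hp => hp.1⟩)
  rw [hasDensity_iff] at hP' hQ ⊢
  refine (hQ.sub hP').congr fun n => ?_
  have : count Q n = count (fun n => P n ∧ Q n) n + count (fun n => ¬ P n ∧ Q n) n := by
    classical
    rw [count, count, count, ← Finset.card_union_of_disjoint]
    · congr 1
      ext k
      simp only [Finset.mem_filter, Finset.mem_union]
      tauto
    · rw [Finset.disjoint_left]
      intro k hk hk'
      simp only [Finset.mem_filter] at hk hk'
      tauto
  rw [this]
  push_cast
  ring

/-! ### Equidistributed fractional parts -/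

theorem FractEquidistributed.exists_lower {x : ℕ → ℝ} (hx : FractEquidistributed x) {q a : ℝ}
    (hq : q ∈ Set.Icc (0 : ℝ) 1) (ha : a < q) :
    ∃ β < q, ∃ d > a, HasDensity (fun n => Int.fract (x n) ≤ β) d := by
  rcases hq.1.eq_or_lt with rfl | hq0
  · refine ⟨-1, by norm_num, 0, ha, hasDensity_of_forall_not fun n _ => ?_⟩
    have := Int.fract_nonneg (x n)
    linarith
  · refine ⟨max ((a + q) / 2) 0, ?_, max ((a + q) / 2) 0, ?_, hx _ ⟨le_max_right _ _, ?_⟩⟩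
    · exact max_lt (by linarith) hq0
    · exact lt_max_of_lt_left (by linarith)
    · exact max_le (by linarith [hq.2]) zero_le_one

theorem FractEquidistributed.exists_upper {x : ℕ → ℝ} (hx : FractEquidistributed x) {q a : ℝ}
    (hq : q ∈ Set.Icc (0 : ℝ) 1) (ha : q < a) :
    ∃ β > q, ∃ d < a, HasDensity (fun n => Int.fract (x n) ≤ β) d := by
  rcases hq.2.eq_or_lt with rfl | hq1
  · refine ⟨2, by norm_num, 1, ha, hasDensity_of_forall fun n _ => ?_⟩
    have := Int.fract_lt_one (x n)
    linarith
  · refine ⟨min ((a + q) / 2) 1, ?_, min ((a + q) / 2) 1, ?_, hx _ ⟨?_, min_le_right _ _⟩⟩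
    · exact lt_min (by linarith) hq1
    · exact min_lt_of_left_lt (by linarith)
    · exact le_min (by linarith [hq.1]) zero_le_one

theorem FractEquidistributed.hasDensity_lt {x : ℕ → ℝ} (hx : FractEquidistributed x)
    {q : ℕ → ℝ} {q₀ : ℝ} (hq₀ : q₀ ∈ Set.Icc (0 : ℝ) 1) (hq : Tendsto q atTop (𝓝 q₀)) :
    HasDensity (fun n => Int.fract (x n) < q n) q₀ := by
  refine hasDensity_of_bounds (fun a ha => ?_) (fun a ha => ?_)
  · obtain ⟨β, hβ, d, hd, h⟩ := hx.exists_lower hq₀ ha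
    refine ⟨_, d, hd, h, ?_⟩
    filter_upwards [(tendsto_order.1 hq).1 β hβ] with n hn hle using hle.trans_lt hn
  · obtain ⟨β, hβ, d, hd, h⟩ := hx.exists_upper hq₀ ha
    refine ⟨_, d, hd, h, ?_⟩
    filter_upwards [(tendsto_order.1 hq).2 β hβ] with n hn hlt using (hlt.trans hn).le

/-! ### Irrational rotations -/

/-- Kronecker: the forward orbit of an irrational rotation is dense, so it enters the arc just after
`-c`. Capping the arc length at `1` makes the representative `c + y` equal to the fractional part.
-/
theorem exists_nat_fract_add_mul_lt {α : ℝ} (hα : Irrational α) (c : ℝ) {η : ℝ} (hη : 0 < η) :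
    ∃ k : ℕ, Int.fract (c + k * α) < η := by
  have hd : DenseRange (fun n : ℕ => n • (α : AddCircle (1 : ℝ))) :=
    denseRange_zsmul_iff_nsmul.1 (AddCircle.denseRange_zsmul_coe_iff.2 (by simpa using hα))
  have hopen : IsOpen ((fun x : ℝ => (x : AddCircle (1 : ℝ))) '' Set.Ioo (-c) (-c + min η 1)) :=
    QuotientAddGroup.isOpenMap_coe _ isOpen_Ioo
  obtain ⟨k, y, hy, hk⟩ := hd.exists_mem_open hopen
    ((Set.nonempty_Ioo.2 (by linarith [lt_min hη one_pos])).image _)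
  refine ⟨k, ?_⟩
  simp only at hk
  rw [← AddCircle.coe_nsmul, ← sub_eq_zero, ← AddCircle.coe_sub, AddCircle.coe_eq_zero_iff] at hk
  obtain ⟨z, hz⟩ := hk
  simp only [zsmul_eq_mul, nsmul_eq_mul, mul_one] at hz
  have hy1 := lt_min_iff.1 (show c + y < min η 1 by linarith [hy.2])
  have : Int.fract (c + k * α) = c + y := by
    rw [Int.fract_eq_iff]
    refine ⟨by linarith [hy.1], hy1.2, -z, ?_⟩
    push_cast
    linarith
  rw [this]
  exact hy1.1

theorem count_le_of_shift {P Q : ℕ → Prop} {k : ℕ} (h : ∀ i, P i → Q (i + k)) (n : ℕ) :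
    count P n ≤ count Q n + k := by
  classical
  have h1 : count P n ≤ ((Finset.Icc 1 n).filter Q ∪ Finset.Ioc n (n + k)).card := by
    refine Finset.card_le_card_of_injOn (fun i => i + k) (fun i hi => ?_)
      (fun i _ j _ hij => by simpa using hij)
    simp only [Finset.coe_filter, Finset.mem_Icc, Set.mem_ofPred_eq, Finset.coe_union,
      Set.mem_union, Finset.coe_Ioc, Set.mem_Ioc] at hi ⊢
    by_cases hik : i + k ≤ n
    · exact Or.inl ⟨⟨by omega, hik⟩, h i hi.2⟩
    · exact Or.inr ⟨by omega, by omega⟩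
  refine h1.trans ((Finset.card_union_le _ _).trans ?_)
  simp [count]

theorem fract_sub_div_lt_iff {q i : ℕ} (hi : i < q) {y : ℝ}
    (h : Int.fract (y - i / q) < 1 / q) : (i : ℤ) = ⌊q * Int.fract y⌋ := by
  have hq : (0 : ℝ) < q := by exact_mod_cast (Nat.zero_le i).trans_lt hi
  have hz : ⌊y - i / q⌋ = ⌊y⌋ := by
    have h1 := Int.fract_add_floor (y - i / q)
    have h2 := Int.fract_add_floor y
    have h3 := Int.fract_nonneg (y - i / q)
    have h4 := Int.fract_nonneg y
    have h5 := Int.fract_lt_one y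
    have h6 : (i : ℝ) / q + 1 / q ≤ 1 := by
      rw [← add_div, div_le_one hq]; exact_mod_cast hi
    have h7 : (0 : ℝ) ≤ i / q := by positivity
    apply le_antisymm
    · have : (⌊y - i / q⌋ : ℝ) < ⌊y⌋ + 1 := by linarith
      exact Int.lt_add_one_iff.1 (by exact_mod_cast this)
    · have : (⌊y⌋ : ℝ) < ⌊y - i / q⌋ + 1 := by linarith
      exact Int.lt_add_one_iff.1 (by exact_mod_cast this)
  have h1 := Int.fract_add_floor (y - i / q)
  have h2 := Int.fract_add_floor y
  have h3 := Int.fract_nonneg (y - i / q)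
  rw [hz] at h1
  have h4 : Int.fract y = i / q + Int.fract (y - i / q) := by linarith
  symm
  rw [Int.floor_eq_iff, h4, mul_add, mul_div_cancel₀ _ hq.ne']
  have h5 : (q : ℝ) * Int.fract (y - i / q) < 1 := by
    rwa [lt_div_iff₀ hq, mul_comm] at h
  have h6 : 0 ≤ (q : ℝ) * Int.fract (y - i / q) := by positivity
  push_cast
  constructor <;> linarith

theorem sum_count_arcs_le (x : ℕ → ℝ) (q n : ℕ) :
    ∑ i ∈ Finset.range q, count (fun k => Int.fract (x k - i / q) < 1 / q) n ≤ n := by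
  classical
  unfold count
  rw [← Finset.card_biUnion]
  · calc _ ≤ (Finset.Icc 1 n).card := Finset.card_le_card
          (Finset.biUnion_subset.2 fun i _ => Finset.filter_subset _ _)
      _ = n := by simp
  · intro i hi j hj hij
    rw [Function.onFun, Finset.disjoint_left]
    intro k hk hk'
    have h1 := fract_sub_div_lt_iff (Finset.mem_range.1 hi) (Finset.mem_filter.1 hk).2
    have h2 := fract_sub_div_lt_iff (Finset.mem_range.1 hj) (Finset.mem_filter.1 hk').2
    exact hij (by exact_mod_cast h1.trans h2.symm)

/-- Some multiple of `α` rotates the arc into each of the `q` disjoint arcs of length `1/q`; the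
slack `1/q - ℓ` absorbs the inexact landing. A rotation shifts the index, which costs only a bounded
number of terms, so `q` copies of the count fit into `n`. -/
theorem exists_count_short_arc_le {α : ℝ} (hα : Irrational α) {q : ℕ} (a : ℝ) {ℓ : ℝ}
    (hℓ : ℓ < 1 / q) :
    ∃ C : ℕ, ∀ n, q * count (fun k => Int.fract (k * α - a) < ℓ) n ≤ n + C := by
  choose k hk using fun i : ℕ =>
    exists_nat_fract_add_mul_lt hα (a - i / q) (η := 1 / q - ℓ) (by linarith)
  refine ⟨∑ i ∈ Finset.range q, k i, fun n => ?_⟩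
  have h := sum_count_arcs_le (fun k => k * α) q n
  calc q * count (fun k => Int.fract (k * α - a) < ℓ) n
      = ∑ i ∈ Finset.range q, count (fun k => Int.fract (k * α - a) < ℓ) n := by simp
    _ ≤ ∑ i ∈ Finset.range q,
        (count (fun k => Int.fract (k * α - i / q) < 1 / q) n + k i) := by
        refine Finset.sum_le_sum fun i _ => count_le_of_shift (fun j hj => ?_) n
        have h1 := Int.fract_add_le (j * α - a) (a - i / q + k i * α)
        rw [show j * α - a + (a - i / q + k i * α) = (j + k i : ℕ) * α - i / q by
          push_cast; ring] at h1
        linarith [hk i]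
    _ ≤ _ := by rw [Finset.sum_add_distrib]; omega

/-- Cut the arc into `p` equal pieces, each shorter than `1/q`. -/
theorem exists_count_arc_le {α : ℝ} (hα : Irrational α) {p q : ℕ} (hp : 0 < p) (a : ℝ) {ℓ : ℝ}
    (hℓ0 : 0 < ℓ) (hℓ : ℓ < p / q) :
    ∃ C : ℕ, ∀ n, q * count (fun k => Int.fract (k * α - a) < ℓ) n ≤ p * n + C := by
  have hp0 : (0 : ℝ) < p := by exact_mod_cast hp
  have hshort : ℓ / p < 1 / q := by
    rw [div_lt_iff₀ hp0, one_div_mul_eq_div]; exact hℓ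
  choose C hC using fun i : ℕ => exists_count_short_arc_le hα (a + i * (ℓ / p)) hshort
  refine ⟨∑ i ∈ Finset.range p, C i, fun n => ?_⟩
  have hcover : count (fun k => Int.fract (k * α - a) < ℓ) n ≤
      ∑ i ∈ Finset.range p, count (fun k => Int.fract (k * α - (a + i * (ℓ / p))) < ℓ / p) n := by
    classical
    unfold count
    refine le_trans (Finset.card_le_card fun k hk => ?_) Finset.card_biUnion_le
    simp only [Finset.mem_filter, Finset.mem_biUnion, Finset.mem_range] at hk ⊢
    have hδ : 0 < ℓ / p := by positivity
    set f := Int.fract (k * α - a) with hf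
    have hf0 : 0 ≤ f := Int.fract_nonneg _
    have h1 : (⌊f / (ℓ / p)⌋₊ : ℝ) ≤ f / (ℓ / p) := Nat.floor_le (by positivity)
    have h2 := Nat.lt_floor_add_one (f / (ℓ / p))
    rw [le_div_iff₀ hδ] at h1
    rw [div_lt_iff₀ hδ, add_mul, one_mul] at h2
    refine ⟨⌊f / (ℓ / p)⌋₊, ?_, hk.1, ?_⟩
    · rw [Nat.floor_lt (by positivity), div_lt_iff₀ hδ, mul_div_cancel₀ _ hp0.ne']
      exact hk.2
    · have : Int.fract (k * α - (a + ⌊f / (ℓ / p)⌋₊ * (ℓ / p))) =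
          f - ⌊f / (ℓ / p)⌋₊ * (ℓ / p) := by
        rw [Int.fract_eq_iff]
        refine ⟨by linarith, ?_, ⌊k * α - a⌋, ?_⟩
        · have := Int.fract_lt_one (k * α - a)
          have : 0 ≤ (⌊f / (ℓ / p)⌋₊ : ℝ) * (ℓ / p) := by positivity
          linarith
        · rw [hf, Int.fract]; ring
      rw [this]
      linarith
  calc _ ≤ q * ∑ i ∈ Finset.range p,
        count (fun k => Int.fract (k * α - (a + i * (ℓ / p))) < ℓ / p) n :=
        Nat.mul_le_mul_left _ hcover
    _ ≤ ∑ i ∈ Finset.range p, (n + C i) := by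
        rw [Finset.mul_sum]
        exact Finset.sum_le_sum fun i _ => hC i n
    _ = _ := by simp [Finset.sum_add_distrib]

theorem eventually_count_arc_lt {α : ℝ} (hα : Irrational α) (a : ℝ) {ℓ b : ℝ}
    (hℓ0 : 0 ≤ ℓ) (hb : ℓ < b) :
    ∀ᶠ n : ℕ in atTop, (count (fun k => Int.fract (k * α - a) < ℓ) n : ℝ) / n < b := by
  obtain ⟨r, hr1, hr2⟩ := exists_rat_btwn hb
  have hr0 : (0 : ℚ) < r := by exact_mod_cast hℓ0.trans_lt hr1
  have hnum : 0 < r.num.toNat := by have := Rat.num_pos.2 hr0; omega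
  have hrd : (r : ℝ) = (r.num.toNat : ℝ) / (r.den : ℝ) := by
    rw [Rat.cast_def]
    congr 1
    exact_mod_cast (Int.toNat_of_nonneg (Rat.num_nonneg.2 hr0.le)).symm
  -- The midpoint replaces `ℓ` because the arc length must be positive and `ℓ` may be `0`.
  obtain ⟨C, hC⟩ := exists_count_arc_le hα (q := r.den) hnum a (ℓ := (ℓ + r) / 2)
    (by linarith) (by rw [← hrd]; linarith)
  have hlim : Tendsto (fun n : ℕ => (r : ℝ) + (C : ℝ) / n) atTop (𝓝 (r + 0)) :=
    tendsto_const_nhds.add (tendsto_const_div_atTop_nhds_zero_nat _)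
  rw [add_zero] at hlim
  filter_upwards [(tendsto_order.1 hlim).2 b hr2, eventually_gt_atTop 0] with n hn hn0
  refine lt_of_le_of_lt ?_ hn
  have hn0' : (0 : ℝ) < n := by exact_mod_cast hn0
  have hden : (1 : ℝ) ≤ r.den := by exact_mod_cast r.den_pos
  have h1 : count (fun k => Int.fract (k * α - a) < ℓ) n ≤
      count (fun k => Int.fract (k * α - a) < (ℓ + r) / 2) n :=
    count_mono fun k _ hk => hk.trans (by linarith)
  have h2 : (r.den : ℝ) * count (fun k => Int.fract (k * α - a) < (ℓ + r) / 2) n ≤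
      r.num.toNat * n + C := by exact_mod_cast hC n
  have h1' : (count (fun k => Int.fract (k * α - a) < ℓ) n : ℝ) ≤
      count (fun k => Int.fract (k * α - a) < (ℓ + r) / 2) n := by exact_mod_cast h1
  have h3 : (r.num.toNat : ℝ) = r * r.den := by rw [hrd]; field_simp
  rw [h3] at h2
  rw [div_le_iff₀ hn0', add_mul, div_mul_cancel₀ _ hn0'.ne']
  refine h1'.trans (le_of_mul_le_mul_left (a := (r.den : ℝ)) ?_ (by linarith))
  have hC0 : (0 : ℝ) ≤ C := Nat.cast_nonneg _
  nlinarith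

/-- Upper bounds for all arcs suffice: the lower bound for `[0, β]` is the upper bound for its
complement, an arc of length `1 - β` starting at `β`. -/
theorem fractEquidistributed_mul_irrational {α : ℝ} (hα : Irrational α) :
    FractEquidistributed fun n => n * α := by
  intro β hβ
  rw [hasDensity_iff, tendsto_order]
  constructor
  · intro a ha
    filter_upwards [eventually_count_arc_lt hα β (ℓ := 1 - β) (b := 1 - a) (by linarith [hβ.2])
      (by linarith), eventually_gt_atTop 0] with n hn hn0
    have hn0' : (0 : ℝ) < n := by exact_mod_cast hn0
    have h1 := count_add_count_not (fun k : ℕ => Int.fract (k * α) ≤ β) n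
    have h2 : count (fun k : ℕ => ¬ Int.fract (k * α) ≤ β) n ≤
        count (fun k => Int.fract (k * α - β) < 1 - β) n := by
      refine count_mono fun k _ hk => ?_
      have h3 := Int.fract_lt_one (k * α)
      have : Int.fract (k * α - β) = Int.fract (k * α) - β := by
        rw [Int.fract_eq_iff]
        exact ⟨by linarith, by linarith [hβ.1], ⌊k * α⌋, by rw [Int.fract]; ring⟩
      rw [this]
      linarith
    have h1' : (count (fun k : ℕ => Int.fract (k * α) ≤ β) n : ℝ) +
        count (fun k : ℕ => ¬ Int.fract (k * α) ≤ β) n = n := by exact_mod_cast h1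
    have h2' : (count (fun k : ℕ => ¬ Int.fract (k * α) ≤ β) n : ℝ) ≤
        count (fun k => Int.fract (k * α - β) < 1 - β) n := by exact_mod_cast h2
    rw [div_lt_iff₀ hn0'] at hn
    rw [lt_div_iff₀ hn0']
    linarith
  · intro a ha
    filter_upwards [eventually_count_arc_lt hα 0 (ℓ := (β + a) / 2) (b := a)
      (by linarith [hβ.1]) (by linarith)] with n hn
    refine lt_of_le_of_lt ?_ hn
    gcongr
    exact count_mono fun k _ hk => by rw [sub_zero]; linarith

section

variable {L : List ℕ} {H : ℕ → ℕ}

/-! ### Leading blocks and intervals -/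

theorem conv_append (u v : List ℕ) :
    conv (u ++ v) H = conv (u ++ List.replicate v.length 0) H + conv v H := by
  induction u with
  | nil => simp [conv_replicate_zero]
  | cons c u ih => simp only [List.cons_append, conv_cons, ih]; simp; omega

/-- Among tuples with a given head the zero-padded one is smallest, so comparison with it depends on
the head alone. -/
theorem Admissible.conv_lt_iff_take (hT : ∀ t, H (t + 1) = valueBound L H 0 t) {ε u : List ℕ}
    (hε : Admissible L 0 ε) (hu : Admissible L 0 u) (hle : u.length ≤ ε.length) :
    conv ε H < conv (u ++ List.replicate (ε.length - u.length) 0) H ↔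
      conv (ε.take u.length) H < conv u H := by
  set w := u ++ List.replicate (ε.length - u.length) 0 with hw
  have hwl : w.length = ε.length := by simp [hw]; omega
  have hwA : Admissible L 0 w := hu.append_zeros _
  have hwt : w.take u.length = u := by simp [hw]
  constructor
  · intro h
    by_contra! hcon
    rcases hcon.eq_or_lt with heq | hlt
    · have htake : ε.take u.length = u :=
        (hε.take _).ext hT hu (by simp [hle]) heq.symm
      have hsplit : ε = u ++ ε.drop u.length := by
        conv_lhs => rw [← List.take_append_drop u.length ε, htake]
      have h1 := conv_append (H := H) u (ε.drop u.length)
      rw [← hsplit, List.length_drop, ← hw] at h1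
      omega
    · have := conv_lt_of_conv_take_lt hT hwA hε hwl (s := u.length) (by rwa [hwt])
      omega
  · intro h
    exact conv_lt_of_conv_take_lt hT hε hwA hwl.symm (s := u.length) (by rwa [hwt])

theorem IsFundamentalSequence.lt_of_lt (hH : IsFundamentalSequence L H) {i j : ℕ} (hi : 1 ≤ i)
    (hij : i < j) : H i < H j :=
  hH.increasing hi (show 1 ≤ j by omega) hij

theorem IsFundamentalSequence.le_of_le (hH : IsFundamentalSequence L H) {i j : ℕ} (hi : 1 ≤ i)
    (hij : i ≤ j) : H i ≤ H j :=
  hH.increasing.monotoneOn hi (show 1 ≤ j by omega) hij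

theorem IsFundamentalSequence.conv_lt (hL : 0 < entry L 1) (hH : IsFundamentalSequence L H)
    {u : List ℕ} (hu : Admissible L 0 u) : conv u H < H (u.length + 1) := by
  rw [hH.eq_valueBound hL]
  exact hu.conv_lt (fun t _ => hH.eq_valueBound hL t) le_rfl

theorem IsFundamentalSequence.length_eq (hL : 0 < entry L 1) (hH : IsFundamentalSequence L H)
    {ε : List ℕ} (hε : ε ∈ collection L) {m : ℕ} (hm : 1 ≤ m) (h1 : H m ≤ conv ε H)
    (h2 : conv ε H < H (m + 1)) : ε.length = m := by
  rw [mem_collection_iff] at hε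
  have h3 := hH.conv_lt hL hε.1
  have h4 := le_conv_of_entry_pos (H := H) hε.2
  apply le_antisymm
  · by_contra! hlt
    have := hH.le_of_le (i := m + 1) (by omega) (show m + 1 ≤ ε.length by omega)
    omega
  · by_contra! hlt
    have := hH.le_of_le (i := ε.length + 1) (by omega) (show ε.length + 1 ≤ m by omega)
    omega

/-- The upper end `B` enters only through `hB`, so that the successor block and the end `H (m + 1)`
of the whole interval are treated alike. -/
theorem hasLeadingBlock_iff_interval (hL : 0 < entry L 1) (hH : IsFundamentalSequence L H)
    {s m K : ℕ} {u : List ℕ} (hu : Admissible L 0 u) (hus : u.length = s) (hm : 1 ≤ m)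
    (hsm : s ≤ m) (h1 : H m ≤ K) (h2 : K < H (m + 1)) {B : ℕ}
    (hB : ∀ ε, Admissible L 0 ε → ε.length = m →
      (conv ε H < B ↔ conv (ε.take s) H ≤ conv u H)) :
    HasLeadingBlock L H s K (u ++ List.replicate (L.length - s) 0) ↔
      ¬ K < conv (u ++ List.replicate (m - s) 0) H ∧ K < B := by
  have hT := hH.eq_valueBound hL
  have key : ∀ ε ∈ collection L, conv ε H = K → (ε.take s = u ↔
      ¬ K < conv (u ++ List.replicate (m - s) 0) H ∧ K < B) := by
    rintro ε hε rfl
    have hl := hH.length_eq hL hε hm h1 h2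
    rw [mem_collection_iff] at hε
    rw [hB ε hε.1 hl, ← hl, ← hus, hε.1.conv_lt_iff_take hT hu (by omega)]
    constructor
    · rintro h; simp [h]
    · rintro ⟨h3, h4⟩
      exact (hε.1.take _).ext hT hu (by simp; omega) (by omega)
  constructor
  · rintro ⟨ε, hε, hc, -, hb⟩
    exact (key ε hε hc).1 (List.append_cancel_right hb).symm
  · intro h
    have hK : 1 ≤ K := (hH.pos m hm).trans_le h1
    obtain ⟨ε, ⟨hε, hc⟩, -⟩ := hH.expansion K hK
    have hl := hH.length_eq hL hε hm (by omega) (by omega)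
    refine ⟨ε, hε, hc, by omega, ?_⟩
    rw [(key ε hε hc).2 h]

theorem eq_append_zeros_of_entry_eq_zero {b : List ℕ} {s : ℕ} (hs : s ≤ b.length)
    (h : ∀ j, s < j → entry b j = 0) :
    b = b.take s ++ List.replicate (b.length - s) 0 := by
  conv_lhs => rw [← List.take_append_drop s b]
  congr 1
  refine List.eq_replicate_iff.2 ⟨by simp, fun x hx => ?_⟩
  obtain ⟨i, hi, rfl⟩ := List.mem_iff_getElem.1 hx
  have hi' : s + i < b.length := by simp at hi; omega
  have := h (s + i + 1) (by omega)
  rw [entry, Nat.add_sub_cancel, List.getD_eq_getElem _ _ hi'] at this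
  simpa using this

theorem leadingBlocks_spec {s : ℕ} (hs : 1 ≤ s) {b : List ℕ} (hb : b ∈ leadingBlocks L H s) :
    b.take s ∈ collection L ∧ (b.take s).length = s ∧
      b = b.take s ++ List.replicate (L.length - s) 0 := by
  obtain ⟨⟨n, -, ε, hε, -, hlen, rfl⟩, hz⟩ := hb
  have h0 : L.length - max s L.length = 0 := by omega
  rw [h0, List.replicate_zero, List.append_nil] at hz ⊢
  have hl : (ε.take (max s L.length)).length = max s L.length := by simp [hlen]
  refine ⟨?_, by simp; omega, ?_⟩
  · rw [List.take_take, min_eq_left (le_max_left _ _)]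
    rw [mem_collection_iff] at hε ⊢
    refine ⟨hε.1.take s, ?_⟩
    cases ε with
    | nil => simp at hlen; omega
    | cons c ε =>
      obtain ⟨r, rfl⟩ : ∃ r, s = r + 1 := ⟨s - 1, by omega⟩
      simpa [entry] using hε.2
  · have := eq_append_zeros_of_entry_eq_zero (by omega) hz
    rwa [hl, show max s L.length - s = L.length - s by omega] at this

theorem append_zeros_mem_collection {u : List ℕ} (hu : u ∈ collection L) (k : ℕ) :
    u ++ List.replicate k 0 ∈ collection L := by
  rw [mem_collection_iff] at hu ⊢
  refine ⟨hu.1.append_zeros k, ?_⟩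
  cases u with
  | nil => simp [entry] at hu
  | cons c u => simpa [entry] using hu.2

theorem append_zeros_mem_leadingBlocks (hH : IsFundamentalSequence L H) {u : List ℕ}
    (hu : u ∈ collection L) (hs : 1 ≤ u.length) :
    u ++ List.replicate (L.length - u.length) 0 ∈ leadingBlocks L H u.length := by
  have hmem := append_zeros_mem_collection hu (L.length - u.length)
  have hlen : (u ++ List.replicate (L.length - u.length) 0).length = max u.length L.length := by
    simp; omega
  refine ⟨⟨_, ?_, _, hmem, rfl, hlen.ge, ?_⟩, fun j hj => ?_⟩
  · exact (hH.pos _ (by simp; omega)).trans_le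
      (le_conv_of_entry_pos ((mem_collection_iff _).1 hmem).2)
  · rw [List.take_of_length_le hlen.le, show L.length - max u.length L.length = 0 by omega]
    simp
  · rw [entry, List.getD_append_right _ _ _ _ (by omega)]
    simp

/-- The density of a leading block is governed by the interval that starts at its own value
and ends at `B m` among the numbers with expansions of length `m`. -/
theorem exists_leadingBlock_interval (hN : 2 ≤ L.length) (hL : 0 < entry L 1)
    (hH : IsFundamentalSequence L H) {s : ℕ} (hs : 1 ≤ s) {b : List ℕ}
    (hb : b ∈ leadingBlocks L H s) :
    ∃ A B : ℕ → ℕ, (∀ m K, s ≤ m → H m ≤ K → K < H (m + 1) →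
        (HasLeadingBlock L H s K b ↔ ¬ K < A m ∧ K < B m)) ∧
      (∀ m, s ≤ m → H m ≤ A m ∧ A m ≤ B m ∧ B m ≤ H (m + 1)) ∧
      Tendsto (fun m => (A m : ℝ) / H m) atTop (𝓝 (dot b (Hhat L))) ∧
      Tendsto (fun m => (B m : ℝ) / H m) atTop (𝓝 (dot (succBlock L H s b) (Hhat L))) := by
  have hT := hH.eq_valueBound hL
  obtain ⟨hu, hus, hbu⟩ := leadingBlocks_spec hs hb
  set u := b.take s with hu_def
  have hlow : ∀ v ∈ collection L, v.length = s → ∀ m, s ≤ m →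
      H m ≤ conv (v ++ List.replicate (m - s) 0) H ∧
      conv (v ++ List.replicate (m - s) 0) H < H (m + 1) := by
    intro v hv hvs m hm
    have hmem := append_zeros_mem_collection hv (m - s)
    have hlen : (v ++ List.replicate (m - s) 0).length = m := by simp; omega
    rw [mem_collection_iff] at hmem
    have h1 := le_conv_of_entry_pos (H := H) hmem.2
    have h2 := hH.conv_lt hL hmem.1
    rw [hlen] at h1 h2
    exact ⟨h1, h2⟩
  have hdotb : dot b (Hhat L) = dot u (Hhat L) := by rw [hbu, dot_append_zeros]
  have hAlim := tendsto_conv_append_zeros hN hL hH u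
  rw [hus, ← hdotb] at hAlim
  have huA := ((mem_collection_iff _).1 hu).1
  by_cases hc : ∃ c ∈ leadingBlocks L H s, conv (c.take s) H = 1 + conv (b.take s) H
  · have hsucc : succBlock L H s b = hc.choose := by rw [succBlock, dif_pos hc]
    obtain ⟨hcb, hcv⟩ := hc.choose_spec
    obtain ⟨hv, hvs, hcu⟩ := leadingBlocks_spec hs hcb
    rw [hsucc]
    set c := hc.choose
    set v := c.take s
    have hvA := ((mem_collection_iff _).1 hv).1
    have hdotc : dot c (Hhat L) = dot v (Hhat L) := by rw [hcu, dot_append_zeros]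
    have hBlim := tendsto_conv_append_zeros hN hL hH v
    rw [hvs, ← hdotc] at hBlim
    refine ⟨_, _, fun m K hsm h1 h2 => ?_, fun m hm => ⟨(hlow u hu hus m hm).1, ?_,
      (hlow v hv hvs m hm).2.le⟩, hAlim, hBlim⟩
    · rw [hbu]
      refine hasLeadingBlock_iff_interval hL hH huA hus (by omega) hsm h1 h2 fun ε hε hl => ?_
      have := hε.conv_lt_iff_take hT hvA (by omega)
      rw [hl, hvs] at this
      rw [this, hcv, ← hu_def]
      omega
    · have hl : (u ++ List.replicate (m - s) 0).length = m := by simp; omega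
      have := (huA.append_zeros (m - s)).conv_lt_iff_take hT hvA (by omega)
      rw [hl, hvs, List.take_left' hus] at this
      exact (this.2 (by rw [hcv, ← hu_def]; omega)).le
  · have hsucc : succBlock L H s b = exclusiveBlock L s := by rw [succBlock, dif_neg hc]
    rw [hsucc, dot_exclusiveBlock hN hL]
    refine ⟨_, fun m => H (m + 1), fun m K hsm h1 h2 => ?_, fun m hm => ⟨(hlow u hu hus m hm).1,
      (hlow u hu hus m hm).2.le, le_rfl⟩, hAlim, tendsto_succ_ratio hN hL hH⟩
    -- Otherwise `conv u H + 1` is the value of an admissible tuple of length `s`. Its first entry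
    -- is nonzero because the value exceeds `H s`, so it gives a successor block, contrary to `hc`.
    have hmax : H (s + 1) ≤ conv u H + 1 := by
      by_contra! hlt
      obtain ⟨v, hv, hvl, hvc⟩ := exists_admissible_conv_eq (L := L) (H := H) (T := s)
        (fun t _ => hT t) s le_rfl 0 (conv u H + 1) (by rwa [← hT])
      have hpos : 0 < entry v 1 := by
        by_contra! h0
        obtain ⟨r, rfl⟩ : ∃ r, s = r + 1 := ⟨s - 1, by omega⟩
        cases v with
        | nil => simp at hvl
        | cons d v =>
          have hd : d = 0 := by simpa [entry] using h0
          have hvl' : v.length = r := by simpa using hvl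
          subst hd
          have hv0 : Admissible L 0 v := by
            rcases hv with ⟨h, -⟩ | ⟨-, h⟩
            · exact absurd h.symm (Theta_one hL).ne'
            · exact h
          have h3 := hH.conv_lt hL hv0
          have h4 := le_conv_of_entry_pos (H := H) ((mem_collection_iff _).1 hu).2
          rw [hvl'] at h3
          rw [hus] at h4
          rw [conv_cons] at hvc
          omega
      refine hc ⟨v ++ List.replicate (L.length - s) 0, ?_, ?_⟩
      · have := append_zeros_mem_leadingBlocks hH ((mem_collection_iff v).2 ⟨hv, hpos⟩) (by omega)
        rwa [hvl] at this
      · rw [List.take_left' hvl, hvc, add_comm]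
    rw [hbu]
    refine hasLeadingBlock_iff_interval hL hH huA hus (by omega) hsm h1 h2 fun ε hε hl => ?_
    have h3 := hH.conv_lt hL hε
    have h4 := hH.conv_lt hL (hε.take s)
    have h5 : (ε.take s).length = s := by simp; omega
    rw [hl] at h3
    rw [h5] at h4
    simp only [h3, true_iff]
    omega

end

section

variable {L : List ℕ} {H : ℕ → ℕ} {h : ℝ → ℝ}

/-! ### Inverses of increasing functions -/

/-- Continuity of the inverse needs only order: `g (q i)` eventually lies between the values of `g`
at points on either side of `p`. -/
theorem tendsto_of_strictMonoOn {ι : Type*} {l : Filter ι} {g : ℝ → ℝ}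
    (hg : StrictMonoOn g (Set.Icc 0 1)) {q : ι → ℝ} {p : ℝ} (hp : p ∈ Set.Icc (0 : ℝ) 1)
    (hq : ∀ᶠ i in l, q i ∈ Set.Icc (0 : ℝ) 1) (hlim : Tendsto (fun i => g (q i)) l (𝓝 (g p))) :
    Tendsto q l (𝓝 p) := by
  rw [tendsto_order] at hlim ⊢
  constructor
  · intro a ha
    by_cases ha0 : 0 ≤ a
    · have haI : a ∈ Set.Icc (0 : ℝ) 1 := ⟨ha0, ha.le.trans hp.2⟩
      filter_upwards [hq, hlim.1 _ (hg haI hp ha)] with i hi hlt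
      exact (hg.lt_iff_lt haI hi).1 hlt
    · filter_upwards [hq] with i hi
      linarith [hi.1]
  · intro a ha
    by_cases ha1 : a ≤ 1
    · have haI : a ∈ Set.Icc (0 : ℝ) 1 := ⟨hp.1.trans ha.le, ha1⟩
      filter_upwards [hq, hlim.2 _ (hg hp haI ha)] with i hi hlt
      exact (hg.lt_iff_lt hi haI).1 hlt
    · filter_upwards [hq] with i hi
      linarith [hi.2]

theorem invUnit_spec {f : ℝ → ℝ} (hc : ContinuousOn f (Set.Icc 0 1)) (h0 : f 0 = 0) (h1 : f 1 = 1)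
    {y : ℝ} (hy : y ∈ Set.Icc (0 : ℝ) 1) : invUnit f y ∈ Set.Icc (0 : ℝ) 1 ∧ f (invUnit f y) = y := by
  have himg : y ∈ f '' Set.Icc 0 1 := by
    have := intermediate_value_Icc (zero_le_one' ℝ) hc
    rw [h0, h1] at this
    exact this hy
  exact ⟨Function.invFunOn_mem himg, Function.invFunOn_eq himg⟩

/-! ### Locating an integer between consecutive terms -/

theorem IsFundamentalSequence.apply_one (hL : 0 < entry L 1) (hH : IsFundamentalSequence L H) :
    H 1 = 1 := by
  rw [hH.eq_valueBound hL 0]; rfl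

theorem IsFundamentalSequence.le_apply (hL : 0 < entry L 1) (hH : IsFundamentalSequence L H)
    (m : ℕ) (hm : 1 ≤ m) : m ≤ H m := by
  induction m, hm using Nat.le_induction with
  | base => exact (hH.apply_one hL).ge
  | succ m hm ih =>
    have := hH.lt_of_lt hm (Nat.lt_succ_self m)
    exact ih.trans_lt this

theorem IsFundamentalSequence.tendsto_natCast_atTop (hL : 0 < entry L 1)
    (hH : IsFundamentalSequence L H) : Tendsto (fun m => (H m : ℝ)) atTop atTop := by
  refine tendsto_atTop_mono' _ ?_ (tendsto_natCast_atTop_atTop (R := ℝ))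
  filter_upwards [eventually_ge_atTop 1] with m hm
  exact_mod_cast hH.le_apply hL m hm

theorem IsFundamentalSequence.exists_level (hL : 0 < entry L 1) (hH : IsFundamentalSequence L H) :
    ∃ lev : ℕ → ℕ, ∀ K, 1 ≤ K → 1 ≤ lev K ∧ H (lev K) ≤ K ∧ K < H (lev K + 1) := by
  have : ∀ K, 1 ≤ K → ∃ m, 1 ≤ m ∧ H m ≤ K ∧ K < H (m + 1) := by
    intro K hK
    obtain ⟨ε, ⟨hε, rfl⟩, -⟩ := hH.expansion K hK
    rw [mem_collection_iff] at hε
    refine ⟨ε.length, ?_, le_conv_of_entry_pos hε.2, hH.conv_lt hL hε.1⟩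
    cases ε with
    | nil => simp [entry] at hε
    | cons => simp
  choose! lev hlev using this
  exact ⟨lev, hlev⟩

theorem tendsto_level (hH : IsFundamentalSequence L H) {lev : ℕ → ℕ}
    (hlev : ∀ K, 1 ≤ K → 1 ≤ lev K ∧ H (lev K) ≤ K ∧ K < H (lev K + 1)) {K : ℕ → ℕ}
    (hK : PosToInfinity K) : Tendsto (fun n => lev (K n)) atTop atTop := by
  rw [tendsto_atTop]
  intro M
  filter_upwards [hK.2.eventually_ge_atTop (H (M + 1)), eventually_ge_atTop 1] with n hn hn1
  by_contra! hlt
  have h1 := hlev _ (hK.1 n hn1)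
  have h2 := hH.le_of_le (i := lev (K n) + 1) (by omega) (show lev (K n) + 1 ≤ M + 1 by omega)
  omega

/-! ### Uniform continuations -/

theorem invHalfLine_apply (hh : StrictMonoOn h (Set.Ici 1)) {x : ℝ} (hx : 1 ≤ x) :
    invHalfLine h (h x) = x :=
  hh.injOn.leftInvOn_invFunOn hx

theorem IsUniformContinuation.apply_add_one (hh : IsUniformContinuation H h) (m : ℕ) :
    h (m + 1) = H (m + 1) := by
  exact_mod_cast hh.interpolates (m + 1) (by omega)

theorem IsUniformContinuation.inv_spec (hh : IsUniformContinuation H h) {m : ℕ} (hm : 1 ≤ m)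
    {y : ℝ} (h1 : H m ≤ y) (h2 : y ≤ H (m + 1)) :
    invHalfLine h y ∈ Set.Icc (m : ℝ) (m + 1) ∧ h (invHalfLine h y) = y := by
  have hm' : (1 : ℝ) ≤ m := by exact_mod_cast hm
  have hsub : Set.Icc (m : ℝ) (m + 1) ⊆ Set.Ici 1 := fun x hx => hm'.trans hx.1
  have hivt := intermediate_value_Icc (show (m : ℝ) ≤ m + 1 by linarith) (hh.continuousOn.mono hsub)
  rw [hh.interpolates m hm, hh.apply_add_one] at hivt
  obtain ⟨x, hx, rfl⟩ := hivt ⟨h1, h2⟩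
  rw [invHalfLine_apply hh.increasing (hsub hx)]
  exact ⟨hx, rfl⟩

theorem IsUniformContinuation.inv_lt_inv_iff (hh : IsUniformContinuation H h) {m : ℕ}
    (hm : 1 ≤ m) {y z : ℝ} (hy1 : H m ≤ y) (hy2 : y ≤ H (m + 1)) (hz1 : H m ≤ z)
    (hz2 : z ≤ H (m + 1)) : invHalfLine h y < invHalfLine h z ↔ y < z := by
  obtain ⟨h1, h2⟩ := hh.inv_spec hm hy1 hy2
  obtain ⟨h3, h4⟩ := hh.inv_spec hm hz1 hz2
  have hm' : (1 : ℝ) ≤ m := by exact_mod_cast hm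
  have := hh.increasing.lt_iff_lt (show invHalfLine h y ∈ Set.Ici 1 from hm'.trans h1.1)
    (show invHalfLine h z ∈ Set.Ici 1 from hm'.trans h3.1)
  rw [h2, h4] at this
  exact this.symm

theorem fract_eq_sub_of_mem {x : ℝ} {m : ℕ} (h1 : (m : ℝ) ≤ x) (h2 : x < m + 1) :
    Int.fract x = x - m := by
  rw [Int.fract_eq_iff]
  exact ⟨by linarith, by linarith, m, by simp⟩

theorem IsUniformContinuation.fract_inv (hh : IsUniformContinuation H h)
    {m : ℕ} (hm : 1 ≤ m) {y : ℝ} (h1 : H m ≤ y) (h2 : y < H (m + 1)) :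
    Int.fract (invHalfLine h y) = invHalfLine h y - m := by
  obtain ⟨h3, h4⟩ := hh.inv_spec hm h1 h2.le
  refine fract_eq_sub_of_mem h3.1 (lt_of_le_of_ne h3.2 fun heq => ?_)
  rw [heq, hh.apply_add_one] at h4
  exact h2.ne' h4

theorem IsUniformContinuation.fract_inv_le_iff (hh : IsUniformContinuation H h)
    {m : ℕ} (hm : 1 ≤ m) {y β : ℝ} (h1 : H m ≤ y) (h2 : y < H (m + 1)) (hβ : 0 ≤ β) :
    Int.fract (invHalfLine h y) ≤ β ↔ y ≤ h (m + β) := by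
  have hm' : (1 : ℝ) ≤ m := by exact_mod_cast hm
  obtain ⟨h3, h4⟩ := hh.inv_spec hm h1 h2.le
  rw [hh.fract_inv hm h1 h2, sub_le_iff_le_add']
  have := hh.increasing.le_iff_le (show invHalfLine h y ∈ Set.Ici 1 from hm'.trans h3.1)
    (show (m : ℝ) + β ∈ Set.Ici 1 from by simp only [Set.mem_Ici]; linarith)
  rw [h4] at this
  exact this.symm

theorem piece_zero (n : ℕ) : piece h n 0 = 0 := by simp [piece]

theorem IsUniformContinuation.piece_eq (hh : IsUniformContinuation H h) {m : ℕ} (hm : 1 ≤ m)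
    (p : ℝ) : piece h m p = (h (m + p) - H m) / (H (m + 1) - H m) := by
  rw [piece, hh.interpolates m hm, hh.apply_add_one]

theorem IsFundamentalSequence.gap_pos (hH : IsFundamentalSequence L H) {m : ℕ} (hm : 1 ≤ m) :
    (0 : ℝ) < H (m + 1) - H m := by
  have : (H m : ℝ) < H (m + 1) := by exact_mod_cast hH.lt_of_lt hm (Nat.lt_succ_self m)
  linarith

/-- The limit of the pieces of a uniform continuation, and its inverse. -/
theorem IsUniformContinuation.limitPiece_spec (hH : IsFundamentalSequence L H)
    (hh : IsUniformContinuation H h) :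
    ContinuousOn (limitPiece h) (Set.Icc 0 1) ∧ StrictMonoOn (limitPiece h) (Set.Icc 0 1) ∧
      TendstoUniformlyOn (piece h) (limitPiece h) atTop (Set.Icc 0 1) ∧
      limitPiece h 0 = 0 ∧ limitPiece h 1 = 1 := by
  obtain ⟨g, hc, hm, hu⟩ := hh.uniform_limit
  have heq : Set.EqOn g (limitPiece h) (Set.Icc 0 1) := fun p hp => (hu.tendsto_at hp).limUnder_eq.symm
  have hu' := hu.congr_right heq
  refine ⟨hc.congr heq.symm, hm.congr heq, hu', ?_, ?_⟩
  · refine tendsto_nhds_unique (hu'.tendsto_at (by simp)) ?_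
    simp [piece_zero]
  · refine tendsto_nhds_unique (hu'.tendsto_at (by simp)) ?_
    refine tendsto_const_nhds.congr' ?_
    filter_upwards [eventually_ge_atTop 1] with n hn
    rw [hh.piece_eq hn, hh.apply_add_one, div_self (hH.gap_pos hn).ne']

/-- Divide numerator and denominator by `H m`. -/
theorem tendsto_normalized (hN : 2 ≤ L.length) (hL : 0 < entry L 1)
    (hH : IsFundamentalSequence L H) {B : ℕ → ℝ} {z : ℝ}
    (hlim : Tendsto (fun m => B m / H m) atTop (𝓝 z)) :
    Tendsto (fun m => (B m - H m) / ((H (m + 1) : ℝ) - H m)) atTop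
      (𝓝 ((z - 1) / (psi L - 1))) := by
  obtain ⟨hψ, -⟩ := psi_spec hN hL
  refine ((hlim.sub_const 1).div ((tendsto_succ_ratio hN hL hH).sub_const 1)
    (by linarith)).congr' ?_
  filter_upwards [eventually_ge_atTop 1] with m hm
  have h1 : (0 : ℝ) < H m := by exact_mod_cast hH.pos m hm
  have h2 := hH.gap_pos hm
  simp only [Pi.div_apply]
  rw [div_sub_one h1.ne', div_sub_one h1.ne', div_div_div_cancel_right₀ h1.ne']

theorem normalized_mem_Icc (hN : 2 ≤ L.length) (hL : 0 < entry L 1)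
    (hH : IsFundamentalSequence L H) {B : ℕ → ℝ} {z : ℝ}
    (hB : ∀ᶠ m in atTop, (H m : ℝ) ≤ B m ∧ B m ≤ H (m + 1))
    (hlim : Tendsto (fun m => B m / H m) atTop (𝓝 z)) :
    (z - 1) / (psi L - 1) ∈ Set.Icc (0 : ℝ) 1 := by
  refine isClosed_Icc.mem_of_tendsto (tendsto_normalized hN hL hH hlim) ?_
  filter_upwards [hB, eventually_ge_atTop 1] with m hm hm1
  have h2 := hH.gap_pos hm1
  exact ⟨div_nonneg (by linarith) h2.le, (div_le_one h2).2 (by linarith)⟩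

/-- The points `p_m = h⁻¹(B_m) - m` satisfy `h_m(p_m) = (B_m - H_m) / (H_{m+1} - H_m)`. As `p_m`
varies with `m`, uniform convergence is what permits replacing `h_m` by `h_∞`. -/
theorem IsUniformContinuation.tendsto_inv (hN : 2 ≤ L.length) (hL : 0 < entry L 1)
    (hH : IsFundamentalSequence L H) (hh : IsUniformContinuation H h) {B : ℕ → ℝ} {z : ℝ}
    (hB : ∀ᶠ m in atTop, (H m : ℝ) ≤ B m ∧ B m ≤ H (m + 1))
    (hlim : Tendsto (fun m => B m / H m) atTop (𝓝 z)) :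
    Tendsto (fun m : ℕ => invHalfLine h (B m) - m) atTop
      (𝓝 (invUnit (limitPiece h) ((z - 1) / (psi L - 1)))) := by
  obtain ⟨hc, hmono, hu, h0, h1⟩ := hh.limitPiece_spec hH
  have hy := normalized_mem_Icc hN hL hH hB hlim
  obtain ⟨hp, hpy⟩ := invUnit_spec hc h0 h1 hy
  have hI : ∀ᶠ m : ℕ in atTop, invHalfLine h (B m) - m ∈ Set.Icc (0 : ℝ) 1 := by
    filter_upwards [hB, eventually_ge_atTop 1] with m hm hm1
    obtain ⟨h3, -⟩ := hh.inv_spec hm1 hm.1 hm.2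
    exact ⟨by linarith [h3.1], by linarith [h3.2]⟩
  refine tendsto_of_strictMonoOn hmono hp hI ?_
  rw [hpy]
  have hdiff : Tendsto (fun m : ℕ => limitPiece h (invHalfLine h (B m) - m) -
      piece h m (invHalfLine h (B m) - m)) atTop (𝓝 0) := by
    rw [Metric.tendsto_nhds]
    intro η hη
    filter_upwards [hI, Metric.tendstoUniformlyOn_iff.1 hu η hη] with m hm hum
    simpa [Real.dist_eq] using hum _ hm
  have := hdiff.add (tendsto_normalized hN hL hH hlim)
  rw [zero_add] at this
  refine this.congr' ?_
  filter_upwards [hB, eventually_ge_atTop 1] with m hm hm1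
  obtain ⟨-, h4⟩ := hh.inv_spec hm1 hm.1 hm.2
  rw [hh.piece_eq hm1, add_sub_cancel, h4]
  ring

/-! ### The Benford continuation -/

theorem benford_natCast_add (m : ℕ) {p : ℝ} (hp0 : 0 ≤ p) (hp1 : p < 1) :
    benford L H (m + p) =
      H m + ((H (m + 1) : ℝ) - H m) * ((psi L ^ p - 1) / (psi L - 1)) := by
  have h1 : ⌊(m : ℝ) + p⌋₊ = m := by
    rw [Nat.floor_eq_iff (by positivity)]
    constructor <;> linarith
  have h2 : Int.fract ((m : ℝ) + p) = p := by
    rw [Int.fract_natCast_add, Int.fract_eq_self.2 ⟨hp0, hp1⟩]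
  rw [benford, h1, h2]

theorem benford_natCast (m : ℕ) : benford L H m = H m := by
  simpa using benford_natCast_add (L := L) (H := H) m le_rfl one_pos

theorem piece_benford (hψ : 1 < psi L) (hH : IsFundamentalSequence L H) {m : ℕ} (hm : 1 ≤ m)
    {p : ℝ} (hp : p ∈ Set.Icc (0 : ℝ) 1) :
    piece (benford L H) m p = (psi L ^ p - 1) / (psi L - 1) := by
  have h1 : benford L H ((m : ℝ) + 1) = H (m + 1) := by
    exact_mod_cast benford_natCast (L := L) (H := H) (m + 1)
  have h2 := hH.gap_pos hm
  rw [piece, h1, benford_natCast]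
  -- At `p = 1` the floor has already passed to the next integer.
  rcases hp.2.eq_or_lt with rfl | hlt
  · rw [h1, div_self h2.ne', Real.rpow_one, div_self (by linarith)]
  · rw [benford_natCast_add m hp.1 hlt]
    field_simp
    ring

theorem limitPiece_benford (hψ : 1 < psi L) (hH : IsFundamentalSequence L H)
    {p : ℝ} (hp : p ∈ Set.Icc (0 : ℝ) 1) :
    limitPiece (benford L H) p = (psi L ^ p - 1) / (psi L - 1) := by
  refine Tendsto.limUnder_eq (tendsto_const_nhds.congr' ?_)
  filter_upwards [eventually_ge_atTop 1] with n hn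
  exact (piece_benford hψ hH hn hp).symm

theorem logb_mem_Icc (hψ : 1 < psi L) {z : ℝ} (hz : (z - 1) / (psi L - 1) ∈ Set.Icc (0 : ℝ) 1) :
    Real.logb (psi L) z ∈ Set.Icc (0 : ℝ) 1 ∧ psi L ^ Real.logb (psi L) z = z := by
  have h0 : 0 < psi L - 1 := by linarith
  have h1 : 0 ≤ z - 1 := by
    have := mul_nonneg hz.1 h0.le
    rwa [div_mul_cancel₀ _ h0.ne'] at this
  have h2 := (div_le_one h0).1 hz.2
  refine ⟨⟨Real.logb_nonneg hψ (by linarith), ?_⟩,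
    Real.rpow_logb (by linarith) hψ.ne' (by linarith)⟩
  rw [← Real.logb_self_eq_one hψ]
  exact (Real.logb_le_logb hψ (by linarith) (by linarith)).2 (by linarith)

theorem limitPiece_benford_logb (hψ : 1 < psi L) (hH : IsFundamentalSequence L H)
    {z : ℝ} (hz : (z - 1) / (psi L - 1) ∈ Set.Icc (0 : ℝ) 1) :
    limitPiece (benford L H) (Real.logb (psi L) z) = (z - 1) / (psi L - 1) := by
  obtain ⟨h1, h2⟩ := logb_mem_Icc hψ hz
  rw [limitPiece_benford hψ hH h1, h2]

/-! ### Leading block densities -/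

/-- On each interval `h⁻¹` is order preserving, so the event compares a fractional part with a
threshold that converges as the level of `K n` tends to infinity. -/
theorem hasDensity_inv_lt (hN : 2 ≤ L.length) (hL : 0 < entry L 1)
    (hH : IsFundamentalSequence L H) (hh : IsUniformContinuation H h) {K : ℕ → ℕ}
    (hK : PosToInfinity K) (hEq : FractEquidistributed fun n => invHalfLine h (K n))
    {lev : ℕ → ℕ} (hlev : ∀ K, 1 ≤ K → 1 ≤ lev K ∧ H (lev K) ≤ K ∧ K < H (lev K + 1))
    {B : ℕ → ℕ} {z : ℝ} (hB : ∀ᶠ m in atTop, H m ≤ B m ∧ B m ≤ H (m + 1))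
    (hlim : Tendsto (fun m => (B m : ℝ) / H m) atTop (𝓝 z)) :
    HasDensity (fun n => K n < B (lev (K n)))
      (invUnit (limitPiece h) ((z - 1) / (psi L - 1))) := by
  have hB' : ∀ᶠ m in atTop, (H m : ℝ) ≤ B m ∧ (B m : ℝ) ≤ H (m + 1) :=
    hB.mono fun m hm => by exact_mod_cast hm
  have hlevK := tendsto_level hH hlev hK
  obtain ⟨hc, -, -, h0, h1⟩ := hh.limitPiece_spec hH
  have hq := (hh.tendsto_inv hN hL hH hB' hlim).comp hlevK
  have hp := (invUnit_spec hc h0 h1 (normalized_mem_Icc hN hL hH hB' hlim)).1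
  refine (hEq.hasDensity_lt hp hq).congr ?_
  filter_upwards [hlevK.eventually hB', eventually_ge_atTop 1] with n hBn hn
  obtain ⟨hm, hl1, hl2⟩ := hlev _ (hK.1 n hn)
  have hl1' : (H (lev (K n)) : ℝ) ≤ K n := by exact_mod_cast hl1
  have hl2' : (K n : ℝ) < H (lev (K n) + 1) := by exact_mod_cast hl2
  rw [hh.fract_inv hm hl1' hl2', Function.comp, sub_lt_sub_iff_right,
    hh.inv_lt_inv_iff hm hl1' hl2'.le hBn.1 hBn.2, Nat.cast_lt]

theorem hasDensity_leadingBlock (hN : 2 ≤ L.length) (hL : 0 < entry L 1)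
    (hH : IsFundamentalSequence L H) (hh : IsUniformContinuation H h) {K : ℕ → ℕ}
    (hK : PosToInfinity K) (hEq : FractEquidistributed fun n => invHalfLine h (K n))
    {s : ℕ} (hs : 1 ≤ s) {b : List ℕ} (hb : b ∈ leadingBlocks L H s) :
    (dot (succBlock L H s b) (Hhat L) - 1) / (psi L - 1) ∈ Set.Icc (0 : ℝ) 1 ∧
      (dot b (Hhat L) - 1) / (psi L - 1) ∈ Set.Icc (0 : ℝ) 1 ∧
      HasDensity (fun n => HasLeadingBlock L H s (K n) b)
        (invUnit (limitPiece h) ((dot (succBlock L H s b) (Hhat L) - 1) / (psi L - 1)) -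
          invUnit (limitPiece h) ((dot b (Hhat L) - 1) / (psi L - 1))) := by
  obtain ⟨A, B, hiff, hAB, hA, hB⟩ := exists_leadingBlock_interval hN hL hH hs hb
  have hAb : ∀ᶠ m in atTop, H m ≤ A m ∧ A m ≤ H (m + 1) := by
    filter_upwards [eventually_ge_atTop s] with m hm
    exact ⟨(hAB m hm).1, (hAB m hm).2.1.trans (hAB m hm).2.2⟩
  have hBb : ∀ᶠ m in atTop, H m ≤ B m ∧ B m ≤ H (m + 1) := by
    filter_upwards [eventually_ge_atTop s] with m hm
    exact ⟨(hAB m hm).1.trans (hAB m hm).2.1, (hAB m hm).2.2⟩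
  obtain ⟨lev, hlev⟩ := hH.exists_level hL
  have hlevK := tendsto_level hH hlev hK
  refine ⟨normalized_mem_Icc hN hL hH (hBb.mono fun m hm => by exact_mod_cast hm) hB,
    normalized_mem_Icc hN hL hH (hAb.mono fun m hm => by exact_mod_cast hm) hA, ?_⟩
  refine ((hasDensity_inv_lt hN hL hH hh hK hEq hlev hAb hA).and_not
    (hasDensity_inv_lt hN hL hH hh hK hEq hlev hBb hB) ?_).congr ?_
  · filter_upwards [hlevK.eventually_ge_atTop s] with n hn hlt
    exact hlt.trans_le (hAB _ hn).2.1
  · filter_upwards [hlevK.eventually_ge_atTop s, eventually_ge_atTop 1] with n hn hn1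
    obtain ⟨-, hl1, hl2⟩ := hlev _ (hK.1 n hn1)
    exact (hiff _ _ hn hl1 hl2).symm

/-! ### A sequence with equidistributed fractional parts -/

/-- The Benford continuation cancels against the inverse of its own piece. With `y = h_m(p)` the
right side is `h(m + p)`. -/
theorem benford_inv_piece (hψ : 1 < psi L) (hH : IsFundamentalSequence L H) {m : ℕ} (hm : 1 ≤ m)
    {y : ℝ} (hy : y ∈ Set.Icc (0 : ℝ) 1) :
    benford L H (m + invUnit (piece (benford L H) m) y) =
      H m + ((H (m + 1) : ℝ) - H m) * y := by
  have h0 : 0 < psi L - 1 := by linarith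
  have hz : ((1 + y * (psi L - 1)) - 1) / (psi L - 1) = y := by field_simp; ring
  obtain ⟨h1, h2⟩ := logb_mem_Icc hψ (by rw [hz]; exact hy)
  have himg : y ∈ piece (benford L H) m '' Set.Icc 0 1 :=
    ⟨_, h1, by rw [piece_benford hψ hH hm h1, h2, hz]⟩
  have h3 : piece (benford L H) m (invUnit (piece (benford L H) m) y) = y :=
    Function.invFunOn_eq himg
  have h4 : benford L H ((m : ℝ) + 1) = H (m + 1) := by
    exact_mod_cast benford_natCast (L := L) (H := H) (m + 1)
  rw [piece, h4, benford_natCast, div_eq_iff (hH.gap_pos hm).ne'] at h3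
  linarith

theorem tendsto_gap_inv (hN : 2 ≤ L.length) (hL : 0 < entry L 1)
    (hH : IsFundamentalSequence L H) :
    Tendsto (fun m => 1 / ((H (m + 1) : ℝ) - H m)) atTop (𝓝 0) := by
  -- The reciprocal gap is the relative position of `H m + 1`, whose ratio to `H m` tends to `1`.
  have hB : Tendsto (fun m => ((H m : ℝ) + 1) / H m) atTop (𝓝 1) := by
    have := (tendsto_inv_atTop_zero.comp (hH.tendsto_natCast_atTop hL)).const_add 1
    rw [add_zero] at this
    refine this.congr' ?_
    filter_upwards [eventually_ge_atTop 1] with m hm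
    have h1 : (0 : ℝ) < H m := by exact_mod_cast hH.pos m hm
    simp only [Function.comp]
    field_simp
  simpa using tendsto_normalized hN hL hH hB

/-- Rounding down can only enlarge the event at `β`. For `β' > β` the difference `h(n + β') - h(n +
β)` eventually exceeds `1`, so the enlarged event lies in the one for `β'`. -/
theorem IsUniformContinuation.floor_sequence (hN : 2 ≤ L.length) (hL : 0 < entry L 1)
    (hH : IsFundamentalSequence L H) (hh : IsUniformContinuation H h) {x : ℕ → ℝ}
    (hx : FractEquidistributed x) :
    PosToInfinity (fun n => ⌊h (n + Int.fract (x n))⌋₊) ∧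
      FractEquidistributed (fun n => invHalfLine h (⌊h (n + Int.fract (x n))⌋₊ : ℕ)) := by
  have hbounds : ∀ n : ℕ, 1 ≤ n → H n ≤ ⌊h (n + Int.fract (x n))⌋₊ ∧
      ⌊h (n + Int.fract (x n))⌋₊ < H (n + 1) := by
    intro n hn
    have hn' : (1 : ℝ) ≤ n := by exact_mod_cast hn
    have h1 := Int.fract_nonneg (x n)
    have h2 := Int.fract_lt_one (x n)
    have h3 : (H n : ℝ) ≤ h (n + Int.fract (x n)) := by
      rw [← hh.interpolates n hn]
      exact hh.increasing.monotoneOn hn' (show (1 : ℝ) ≤ _ by linarith) (by linarith)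
    have h4 : h (n + Int.fract (x n)) < H (n + 1) := by
      rw [← hh.apply_add_one n]
      exact hh.increasing (show (1 : ℝ) ≤ _ by linarith) (show (1 : ℝ) ≤ _ by linarith)
        (by linarith)
    exact ⟨Nat.le_floor h3, (Nat.floor_lt ((Nat.cast_nonneg _).trans h3)).2 h4⟩
  refine ⟨⟨fun n hn => (hH.pos n hn).trans_le (hbounds n hn).1, ?_⟩, ?_⟩
  · refine tendsto_atTop_mono' _ ?_ tendsto_id
    filter_upwards [eventually_ge_atTop 1] with n hn
    exact (hH.le_apply hL n hn).trans (hbounds n hn).1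
  obtain ⟨-, hmono, hu, -, -⟩ := hh.limitPiece_spec hH
  intro β hβ
  have hiff : ∀ n : ℕ, 1 ≤ n → (Int.fract (invHalfLine h (⌊h (n + Int.fract (x n))⌋₊ : ℕ)) ≤ β ↔
      (⌊h (n + Int.fract (x n))⌋₊ : ℝ) ≤ h (n + β)) := by
    intro n hn
    have hn' : (1 : ℝ) ≤ n := by exact_mod_cast hn
    have h1 : (H n : ℝ) ≤ (⌊h (n + Int.fract (x n))⌋₊ : ℕ) := by exact_mod_cast (hbounds n hn).1
    have h2 : ((⌊h (n + Int.fract (x n))⌋₊ : ℕ) : ℝ) < H (n + 1) := by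
      exact_mod_cast (hbounds n hn).2
    exact hh.fract_inv_le_iff hn h1 h2 hβ.1
  have hle : ∀ n : ℕ, 1 ≤ n → Int.fract (x n) ≤ β → (⌊h (n + Int.fract (x n))⌋₊ : ℝ) ≤ h (n + β) := by
    intro n hn hf
    have hn' : (1 : ℝ) ≤ n := by exact_mod_cast hn
    have h1 := Int.fract_nonneg (x n)
    have h2 : h (n + Int.fract (x n)) ≤ h (n + β) :=
      hh.increasing.monotoneOn (show (1 : ℝ) ≤ _ by linarith) (show (1 : ℝ) ≤ _ by linarith)
        (by linarith)
    refine (Nat.floor_le ?_).trans h2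
    refine le_trans ?_ (hh.increasing.monotoneOn (show (1 : ℝ) ≤ n from hn')
      (show (1 : ℝ) ≤ _ by linarith) (show (n : ℝ) ≤ n + Int.fract (x n) by linarith))
    rw [hh.interpolates n hn]
    positivity
  refine hasDensity_of_bounds (fun a ha => ⟨_, β, ha, hx β hβ, ?_⟩) (fun a ha => ?_)
  · filter_upwards [eventually_ge_atTop 1] with n hn hf
    exact (hiff n hn).2 (hle n hn hf)
  · obtain ⟨β', hβ', d, hd, hdens⟩ := hx.exists_upper hβ ha
    refine ⟨_, d, hd, hdens, ?_⟩
    by_cases h1 : β' ≤ 1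
    · have hβ'I : β' ∈ Set.Icc (0 : ℝ) 1 := ⟨hβ.1.trans hβ'.le, h1⟩
      have hlim := ((hu.tendsto_at hβ).add (tendsto_gap_inv hN hL hH)).sub (hu.tendsto_at hβ'I)
      have hneg : limitPiece h β + 0 - limitPiece h β' < 0 := by
        linarith [hmono hβ hβ'I hβ']
      filter_upwards [eventually_ge_atTop 1, (tendsto_order.1 hlim).2 0 hneg] with n hn hlt hR
      rw [hiff n hn] at hR
      by_contra! hgt
      have hn' : (1 : ℝ) ≤ n := by exact_mod_cast hn
      have hgap := hH.gap_pos hn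
      rw [hh.piece_eq hn, hh.piece_eq hn, ← add_div, ← sub_div, div_neg_iff] at hlt
      have h2 : h (n + β) + 1 < h (n + β') := by
        rcases hlt with h | h
        · linarith
        · linarith
      have h3 : h (n + β') < h (n + Int.fract (x n)) :=
        hh.increasing (show (1 : ℝ) ≤ _ by linarith [hβ'I.1])
          (show (1 : ℝ) ≤ _ by linarith [hβ'I.1]) (by linarith)
      have h4 := Nat.lt_floor_add_one (h (n + Int.fract (x n)))
      linarith
    · refine Eventually.of_forall fun n _ => ?_
      linarith [Int.fract_lt_one (x n)]

end

section

variable {L : List ℕ} {H : ℕ → ℕ}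

/-! ### Approximating values by leading blocks -/

theorem exists_Theta_le (L : List ℕ) : ∃ A, ∀ k, Theta L k ≤ A := by
  refine ⟨L.sum, fun k => ?_⟩
  rw [Theta]
  by_cases hk : (k - 1) % L.length < L.length
  · rw [List.getD_eq_getElem _ _ hk]
    exact List.le_sum_of_mem (List.getElem_mem hk)
  · rw [List.getD_eq_default _ _ (not_lt.1 hk)]
    exact Nat.zero_le _

/-- Entries are bounded by some `A`. Terms from `s₀` on are at most `A (C + 1) θ^k` for every `s`
and `m`, a small geometric tail; the finitely many earlier terms tend to `0`. -/
theorem exists_abs_dot_sub_le (hN : 2 ≤ L.length) (hL : 0 < entry L 1)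
    (hH : IsFundamentalSequence L H) {η : ℝ} (hη : 0 < η) :
    ∃ s₀ : ℕ, ∀ᶠ m in atTop, ∀ ε, Admissible L 0 ε → ε.length = m → ∀ s, s₀ ≤ s → s ≤ m →
      |dot (ε.take s) (Hhat L) - (conv ε H : ℝ) / H m| ≤ η := by
  obtain ⟨A, hA⟩ := exists_Theta_le L
  obtain ⟨C, hC0, hC⟩ := exists_ratio_le hN hL hH
  obtain ⟨hψ, -⟩ := psi_spec hN hL
  have htend := tendsto_ratio hN hL hH
  set θ := (psi L)⁻¹ with hθ
  have hθ0 : 0 < θ := inv_pos.2 (by linarith)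
  have hθ1 : θ < 1 := inv_lt_one_of_one_lt₀ hψ
  have htail : Tendsto (fun s : ℕ => (A : ℝ) * (C + 1) * (θ ^ s / (1 - θ))) atTop (𝓝 0) := by
    simpa using ((tendsto_pow_atTop_nhds_zero_of_lt_one hθ0.le hθ1).div_const (1 - θ)).const_mul
      ((A : ℝ) * (C + 1))
  obtain ⟨s₀, hs₀⟩ := ((tendsto_order.1 htail).2 (η / 2) (by linarith)).exists
  have hhead : Tendsto (fun m => ∑ k ∈ Finset.range s₀,
      (A : ℝ) * |θ ^ k - (H (m - k) : ℝ) / H m|) atTop (𝓝 0) := by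
    have : Tendsto (fun m => ∑ k ∈ Finset.range s₀,
      (A : ℝ) * |θ ^ k - (H (m - k) : ℝ) / H m|) atTop
        (𝓝 (∑ k ∈ Finset.range s₀, (A : ℝ) * |θ ^ k - θ ^ k|)) :=
      tendsto_finsetSum _ fun k _ => ((htend k).const_sub (θ ^ k)).abs.const_mul _
    simpa using this
  refine ⟨s₀, ?_⟩
  filter_upwards [(tendsto_order.1 hhead).2 (η / 2) (by linarith), eventually_ge_atTop s₀] with
    m hm hms ε hε hl s hs hsm
  have hdot : dot (ε.take s) (Hhat L) =
      ∑ k ∈ Finset.range m, (ε.getD k 0 : ℝ) * (if k < s then θ ^ k else 0) := by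
    rw [dot_eq_sum_range, List.length_take, hl, min_eq_left hsm]
    obtain ⟨r, rfl⟩ := Nat.exists_eq_add_of_le hsm
    rw [Finset.sum_range_add]
    simp only [add_lt_iff_neg_left, not_lt_zero, if_false, mul_zero, Finset.sum_const_zero,
      add_zero]
    refine Finset.sum_congr rfl fun k hk => ?_
    have hk := Finset.mem_range.1 hk
    rw [if_pos hk, Hhat_succ]
    congr 2
    simp [List.getD_eq_getElem?_getD, hk]
  have hconv : (conv ε H : ℝ) / H m =
      ∑ k ∈ Finset.range m, (ε.getD k 0 : ℝ) * ((H (m - k) : ℝ) / H m) := by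
    rw [conv_eq_sum_range, hl]
    push_cast
    rw [Finset.sum_div]
    exact Finset.sum_congr rfl fun k _ => by ring
  rw [hdot, hconv, ← Finset.sum_sub_distrib]
  simp only [← mul_sub]
  have hterm : ∀ k, |(ε.getD k 0 : ℝ) * ((if k < s then θ ^ k else 0) - (H (m - k) : ℝ) / H m)| ≤
      (A : ℝ) * |(if k < s then θ ^ k else 0) - (H (m - k) : ℝ) / H m| := by
    intro k
    rw [abs_mul, abs_of_nonneg (by positivity : (0 : ℝ) ≤ (ε.getD k 0 : ℝ))]
    have : (ε.getD k 0 : ℝ) ≤ A := by exact_mod_cast hε.entry_le hA k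
    gcongr
  refine (Finset.abs_sum_le_sum_abs _ _).trans ((Finset.sum_le_sum fun k _ => hterm k).trans ?_)
  obtain ⟨r, rfl⟩ := Nat.exists_eq_add_of_le hms
  rw [Finset.sum_range_add]
  have h1 : ∑ k ∈ Finset.range s₀, (A : ℝ) *
      |(if k < s then θ ^ k else 0) - (H (s₀ + r - k) : ℝ) / H (s₀ + r)| ≤ η / 2 := by
    refine le_trans (le_of_eq (Finset.sum_congr rfl fun k hk => ?_)) hm.le
    rw [if_pos ((Finset.mem_range.1 hk).trans_le hs)]
  have h2 : ∑ k ∈ Finset.range r, (A : ℝ) *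
      |(if s₀ + k < s then θ ^ (s₀ + k) else 0) - (H (s₀ + r - (s₀ + k)) : ℝ) / H (s₀ + r)| ≤
      η / 2 := by
    calc _ ≤ ∑ k ∈ Finset.range r, (A : ℝ) * (C + 1) * θ ^ s₀ * θ ^ k := by
          refine Finset.sum_le_sum fun k hk => ?_
          have hk := Finset.mem_range.1 hk
          have h3 := hC (s₀ + k) (s₀ + r) (by omega)
          have h4 : (0 : ℝ) ≤ (H (s₀ + r - (s₀ + k)) : ℝ) / H (s₀ + r) := by positivity
          have h5 : 0 < θ ^ (s₀ + k) := by positivity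
          rw [mul_assoc, mul_assoc, ← pow_add]
          refine mul_le_mul_of_nonneg_left ?_ (Nat.cast_nonneg _)
          rw [abs_le]
          split_ifs <;> constructor <;> nlinarith
      _ = (A : ℝ) * (C + 1) * θ ^ s₀ * ∑ k ∈ Finset.range r, θ ^ k := by rw [Finset.mul_sum]
      _ ≤ (A : ℝ) * (C + 1) * θ ^ s₀ * (1 / (1 - θ)) := by
          refine mul_le_mul_of_nonneg_left ?_ (by positivity)
          rw [le_div_iff₀ (by linarith), mul_comm, mul_neg_geom_sum]
          have : 0 < θ ^ r := by positivity
          linarith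
      _ = (A : ℝ) * (C + 1) * (θ ^ s₀ / (1 - θ)) := by ring
      _ ≤ η / 2 := hs₀.le
  linarith

/-- Expand `⌊z H_m⌋` for the midpoint `z` and large `m`. Rounding and the approximation of `dot`
each cost at most an eighth of the interval. -/
theorem exists_dot_mem_Ioo (hN : 2 ≤ L.length) (hL : 0 < entry L 1)
    (hH : IsFundamentalSequence L H) {z₁ z₂ : ℝ} (h1 : 1 ≤ z₁) (h12 : z₁ < z₂) (h2 : z₂ ≤ psi L) :
    ∃ u ∈ collection L, z₁ < dot u (Hhat L) ∧ dot u (Hhat L) < z₂ := by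
  obtain ⟨s₀, hs₀⟩ := exists_abs_dot_sub_le hN hL hH (η := (z₂ - z₁) / 8) (by linarith)
  set z := (z₁ + z₂) / 2 with hz
  have hinv : Tendsto (fun m => 1 / (H m : ℝ)) atTop (𝓝 0) := by
    simpa [Function.comp_def] using tendsto_inv_atTop_zero.comp (hH.tendsto_natCast_atTop hL)
  obtain ⟨m, hm, hms, hm1, hmr, hmi⟩ := (hs₀.and ((eventually_ge_atTop s₀).and
    ((eventually_ge_atTop 1).and
    (((tendsto_order.1 (tendsto_succ_ratio hN hL hH)).1 z (by linarith)).and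
    ((tendsto_order.1 hinv).2 ((z₂ - z₁) / 8) (by linarith)))))).exists
  have hHm : (0 : ℝ) < H m := by exact_mod_cast hH.pos m hm1
  have hz0 : 0 ≤ z * H m := mul_nonneg (by linarith) hHm.le
  have hf1 := Nat.floor_le hz0
  have hf2 := Nat.lt_floor_add_one (z * H m)
  have hlow : H m ≤ ⌊z * H m⌋₊ := Nat.le_floor (by nlinarith)
  have hup : ⌊z * H m⌋₊ < H (m + 1) := by
    rw [lt_div_iff₀ hHm] at hmr
    exact (Nat.floor_lt hz0).2 hmr
  obtain ⟨u, ⟨hu, huc⟩, -⟩ := hH.expansion _ ((hH.pos m hm1).trans_le hlow)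
  have hul := hH.length_eq hL hu hm1 (by omega) (by omega)
  have hmain := hm u ((mem_collection_iff u).1 hu).1 hul m hms le_rfl
  rw [List.take_of_length_le hul.le, huc, abs_le] at hmain
  have hq1 : (⌊z * H m⌋₊ : ℝ) / H m ≤ z := (div_le_iff₀ hHm).2 hf1
  have hq2 : z - 1 / H m ≤ (⌊z * H m⌋₊ : ℝ) / H m := by
    rw [le_div_iff₀ hHm, sub_mul, div_mul_cancel₀ _ hHm.ne']
    linarith
  exact ⟨u, hu, by linarith, by linarith⟩

/-! ### Finite tuples as infinite tuples -/

theorem trunc_entry (u : List ℕ) (s : ℕ) :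
    trunc (entry u) s = (u ++ List.replicate s 0).take s := by
  refine List.ext_getElem (by simp [length_trunc]) fun k h1 h2 => ?_
  rw [length_trunc] at h1
  simp only [trunc, segment, List.getElem_map, List.getElem_range, List.getElem_take, entry,
    Nat.add_sub_cancel_left]
  by_cases hk : k < u.length
  · rw [List.getD_eq_getElem _ _ hk, List.getElem_append_left hk]
  · rw [List.getD_eq_default _ _ (not_lt.1 hk), List.getElem_append_right (not_lt.1 hk)]
    simp

/-- No tail equals `Θ`, because `Θ` contains `a_1 > 0` in every period. Finite tuples extended by
zeros are enough test tuples, since their values are dense in `[1, ψ]`. -/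
theorem entry_mem_infCollection (hN : 2 ≤ L.length) (hL : 0 < entry L 1) {u : List ℕ}
    (hu : u ∈ collection L) : entry u ∈ infCollection L := by
  have hu' := (mem_collection_iff u).1 hu
  refine ⟨⟨1, le_rfl, hu'.2, fun j h1 h2 => by omega, fun k hk => ?_⟩, fun j hj => ?_⟩
  · change trunc (entry u) k ∈ collection L
    rw [trunc_entry, mem_collection_iff]
    refine ⟨(hu'.1.append_zeros k).take k, ?_⟩
    cases u with
    | nil => simp [entry] at hu'
    | cons c u =>
      obtain ⟨r, rfl⟩ : ∃ r, k = r + 1 := ⟨k - 1, by omega⟩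
      simpa [entry] using hu'.2
  · have h1 := hj (L.length * (u.length + 1) + 1) (by omega)
    have h2 : u.length + 1 ≤ L.length * (u.length + 1) := Nat.le_mul_of_pos_left _ (by omega)
    rw [entry, List.getD_eq_default _ _ (by omega)] at h1
    have h3 : Theta L (L.length * (u.length + 1) + 1) = entry L 1 := by simp [Theta, entry]
    omega

theorem dotInf_entry (u : List ℕ) : dotInf L (entry u) = dot u (Hhat L) := by
  rw [dotInf, dot_eq_sum_range, tsum_eq_sum (s := Finset.range u.length)]
  · simp [entry]
  · intro k hk
    rw [entry, List.getD_eq_default _ _ (by simpa using hk)]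
    simp

theorem dot_trunc_entry {u : List ℕ} {s : ℕ} (hs : u.length ≤ s) :
    dot (trunc (entry u) s) (Hhat L) = dot u (Hhat L) := by
  rw [trunc_entry, List.take_append, List.take_of_length_le hs, List.take_replicate,
    dot_append_zeros]

/-! ### The distribution inside the intervals `[H_m, H_{m+1})` -/

theorem abs_le_of_hasLeadingBlock (hL : 0 < entry L 1)
    (hH : IsFundamentalSequence L H) {η : ℝ} {s m K : ℕ} (hsm : s ≤ m) (hm1 : 1 ≤ m)
    (hm : ∀ ε, Admissible L 0 ε → ε.length = m →
      |dot (ε.take s) (Hhat L) - (conv ε H : ℝ) / H m| ≤ η)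
    (h1 : H m ≤ K) (h2 : K < H (m + 1)) :
    (∃ b, HasLeadingBlock L H s K b) ∧
      ∀ b, HasLeadingBlock L H s K b → |dot b (Hhat L) - (K : ℝ) / H m| ≤ η := by
  constructor
  · obtain ⟨ε, ⟨hε, hc⟩, -⟩ := hH.expansion K ((hH.pos m hm1).trans_le h1)
    have hl := hH.length_eq hL hε hm1 (by omega) (by omega)
    exact ⟨_, ε, hε, hc, by omega, rfl⟩
  · rintro b ⟨ε, hε, rfl, -, rfl⟩
    rw [dot_append_zeros]
    exact hm ε ((mem_collection_iff ε).1 hε).1 (hH.length_eq hL hε hm1 h1 h2)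

/-- The event says that `K_n / H_m` is at most a threshold tending to `1 + (ψ - 1) y`. Leading block
events for finite tuples of slightly smaller and slightly larger value squeeze it, and continuity of
`f` makes their densities approach `f y`. -/
theorem HasContinuousLeadingBlockDistribution.hasDensity (hN : 2 ≤ L.length) (hL : 0 < entry L 1)
    (hH : IsFundamentalSequence L H) {K : ℕ → ℕ} {f : ℝ → ℝ}
    (hK : HasContinuousLeadingBlockDistribution L H K f) {lev : ℕ → ℕ}
    (hlev : ∀ K, 1 ≤ K → 1 ≤ lev K ∧ H (lev K) ≤ K ∧ K < H (lev K + 1)) {y : ℝ}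
    (hy : y ∈ Set.Icc (0 : ℝ) 1) :
    HasDensity (fun n => (K n : ℝ) ≤ H (lev (K n)) +
      ((H (lev (K n) + 1) : ℝ) - H (lev (K n))) * y) (f y) := by
  obtain ⟨hψ, -⟩ := psi_spec hN hL
  have hψ0 : 0 < psi L - 1 := by linarith
  have hlevK := tendsto_level hH hlev hK.posToInfinity
  have hT : Tendsto (fun n => ((H (lev (K n)) : ℝ) +
      ((H (lev (K n) + 1) : ℝ) - H (lev (K n))) * y) / H (lev (K n))) atTop
      (𝓝 (1 + (psi L - 1) * y)) := by
    refine ((((tendsto_succ_ratio hN hL hH).sub_const 1).mul_const y).const_add 1 |>.comp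
      hlevK).congr' ?_
    filter_upwards [eventually_ge_atTop 1] with n hn
    have h1 : (0 : ℝ) < H (lev (K n)) := by
      exact_mod_cast hH.pos _ (hlev _ (hK.posToInfinity.1 n hn)).1
    simp only [Function.comp]
    field_simp
  -- A single `s` is taken so large that the density at `s` is near its limit, truncation loses
  -- nothing of `u`, and the block value is within `η` of `K_n / H_m`.
  have hpick : ∀ u ∈ collection L, ∀ η > 0, ∀ S : Set ℝ, IsOpen S →
      f ((dot u (Hhat L) - 1) / (psi L - 1)) ∈ S → ∃ s, ∃ d ∈ S,
        HasDensity (fun n => LeadingBlockLE L H s (K n) (trunc (entry u) s)) d ∧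
        dot (trunc (entry u) s) (Hhat L) = dot u (Hhat L) ∧
        ∀ᶠ n in atTop, (∃ b, HasLeadingBlock L H s (K n) b) ∧
          ∀ b, HasLeadingBlock L H s (K n) b →
            |dot b (Hhat L) - (K n : ℝ) / H (lev (K n))| ≤ η := by
    intro u hu η hη S hS hfS
    obtain ⟨d, hd1, hd2⟩ := hK.isHStar.limit (entry u) (entry_mem_infCollection hN hL hu)
      ((mem_collection_iff u).1 hu).2
    rw [dotInf_entry] at hd2
    obtain ⟨s₀, hs₀⟩ := exists_abs_dot_sub_le hN hL hH hη
    obtain ⟨s, hs1, hs2, hs3, hs4⟩ := (hd1.and ((hd2.eventually (hS.mem_nhds hfS)).and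
      ((eventually_ge_atTop s₀).and (eventually_ge_atTop u.length)))).exists
    refine ⟨s, d s, hs2, hs1, dot_trunc_entry hs4, ?_⟩
    filter_upwards [hlevK.eventually hs₀, hlevK.eventually_ge_atTop s,
      eventually_ge_atTop 1] with n hn hns hn1
    obtain ⟨h1, h2, h3⟩ := hlev _ (hK.posToInfinity.1 n hn1)
    exact abs_le_of_hasLeadingBlock hL hH hns h1 (fun ε hε hl => hn ε hε hl s hs3 hns) h2 h3
  have hposH : ∀ᶠ n in atTop, (0 : ℝ) < H (lev (K n)) := by
    filter_upwards [eventually_ge_atTop 1] with n hn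
    exact_mod_cast hH.pos _ (hlev _ (hK.posToInfinity.1 n hn)).1
  have hnorm : ∀ {z w : ℝ}, 1 + (psi L - 1) * w < z → w < (z - 1) / (psi L - 1) := fun h => by
    rw [lt_div_iff₀ hψ0]; linarith
  have hnorm' : ∀ {z w : ℝ}, z < 1 + (psi L - 1) * w → (z - 1) / (psi L - 1) < w := fun h => by
    rw [div_lt_iff₀ hψ0]; linarith
  refine hasDensity_of_bounds (fun a ha => ?_) (fun a ha => ?_)
  -- At `y = 0` no tuple has smaller value, but `f 0 = 0` lets the empty event serve.
  · rcases hy.1.eq_or_lt with rfl | hy0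
    · rw [hK.isHStar.zero] at ha
      exact ⟨fun _ => False, 0, ha, hasDensity_of_forall_not fun _ _ => id, by simp⟩
    · have hnear := (hK.continuousOn y hy).eventually (lt_mem_nhds ha)
      obtain ⟨δ, hδ, hball⟩ := Metric.mem_nhdsWithin_iff.1 hnear
      have hy' : max 0 (y - δ) < y := max_lt hy0 (by linarith)
      obtain ⟨u, hu, hu1, hu2⟩ := exists_dot_mem_Ioo hN hL hH
        (z₁ := 1 + (psi L - 1) * max 0 (y - δ)) (z₂ := 1 + (psi L - 1) * y)
        (by have := mul_nonneg hψ0.le (le_max_left 0 (y - δ)); linarith)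
        (by have := mul_lt_mul_of_pos_left hy' hψ0; linarith)
        (by have := mul_le_mul_of_nonneg_left hy.2 hψ0.le; linarith)
      have hu1' := max_lt_iff.1 (hnorm hu1)
      have hu2' := hnorm' hu2
      have hfu : a < f ((dot u (Hhat L) - 1) / (psi L - 1)) := by
        refine hball ⟨?_, hu1'.1.le, hu2'.le.trans hy.2⟩
        rw [Metric.mem_ball, Real.dist_eq, abs_lt]
        constructor <;> linarith [hu1'.2]
      -- Half of the distance from the value of `u` to `1 + (ψ - 1) y` covers the block error, the
      -- other half the error of the moving threshold.
      obtain ⟨s, d, hd, hdens, hdot, hev⟩ := hpick u hu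
        ((1 + (psi L - 1) * y - dot u (Hhat L)) / 2) (by linarith) (Set.Ioi a) isOpen_Ioi hfu
      refine ⟨_, d, hd, hdens, ?_⟩
      filter_upwards [hev, hposH, (tendsto_order.1 hT).1
        (dot u (Hhat L) + (1 + (psi L - 1) * y - dot u (Hhat L)) / 2) (by linarith)] with
        n hn hpos hTn
      rintro ⟨b, hb, hble⟩
      have h1 := abs_le.1 (hn.2 b hb)
      rw [hdot] at hble
      have h2 : (K n : ℝ) / H (lev (K n)) ≤ ((H (lev (K n)) : ℝ) +
        ((H (lev (K n) + 1) : ℝ) - H (lev (K n))) * y) / H (lev (K n)) := by linarith [h1.1]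
      exact (div_le_div_iff_of_pos_right hpos).1 h2
  · rcases hy.2.eq_or_lt with rfl | hy1
    · rw [hK.isHStar.one] at ha
      exact ⟨fun _ => True, 1, ha, hasDensity_of_forall fun _ _ => trivial, by simp⟩
    · have hnear := (hK.continuousOn y hy).eventually (gt_mem_nhds ha)
      obtain ⟨δ, hδ, hball⟩ := Metric.mem_nhdsWithin_iff.1 hnear
      have hy' : y < min 1 (y + δ) := lt_min hy1 (by linarith)
      obtain ⟨u, hu, hu1, hu2⟩ := exists_dot_mem_Ioo hN hL hH
        (z₁ := 1 + (psi L - 1) * y) (z₂ := 1 + (psi L - 1) * min 1 (y + δ))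
        (by have := mul_nonneg hψ0.le hy.1; linarith)
        (by have := mul_lt_mul_of_pos_left hy' hψ0; linarith)
        (by have := mul_le_mul_of_nonneg_left (min_le_left 1 (y + δ)) hψ0.le; linarith)
      have hu1' := hnorm hu1
      have hu2' := lt_min_iff.1 (hnorm' hu2)
      have hfu : f ((dot u (Hhat L) - 1) / (psi L - 1)) < a := by
        refine hball ⟨?_, hy.1.trans hu1'.le, hu2'.1.le⟩
        rw [Metric.mem_ball, Real.dist_eq, abs_lt]
        constructor <;> linarith [hu2'.2]
      obtain ⟨s, d, hd, hdens, hdot, hev⟩ := hpick u hu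
        ((dot u (Hhat L) - (1 + (psi L - 1) * y)) / 2) (by linarith) (Set.Iio a) isOpen_Iio hfu
      refine ⟨_, d, hd, hdens, ?_⟩
      filter_upwards [hev, hposH, (tendsto_order.1 hT).2
        (dot u (Hhat L) - (dot u (Hhat L) - (1 + (psi L - 1) * y)) / 2) (by linarith)] with
        n hn hpos hTn hle
      obtain ⟨b, hb⟩ := hn.1
      have h1 := abs_le.1 (hn.2 b hb)
      have h2 := (div_le_div_iff_of_pos_right hpos).2 hle
      exact ⟨b, hb, by rw [hdot]; linarith [h1.2]⟩

/-! ### The continuation with prescribed pieces -/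

/-- The function that interpolates `H` by rescaled copies of `g` between consecutive integers. -/
def interpolation (H : ℕ → ℕ) (g : ℝ → ℝ) (x : ℝ) : ℝ :=
  (H ⌊x⌋₊ : ℝ) + ((H (⌊x⌋₊ + 1) : ℝ) - H ⌊x⌋₊) * g (Int.fract x)

theorem interpolation_natCast_add {g : ℝ → ℝ} (h0 : g 0 = 0) (h1 : g 1 = 1) (m : ℕ) {p : ℝ}
    (hp : p ∈ Set.Icc (0 : ℝ) 1) :
    interpolation H g (m + p) = H m + ((H (m + 1) : ℝ) - H m) * g p := by
  have key : ∀ (m : ℕ) (p : ℝ), 0 ≤ p → p < 1 →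
      interpolation H g (m + p) = H m + ((H (m + 1) : ℝ) - H m) * g p := by
    intro m p hp0 hp1
    have h1 : ⌊(m : ℝ) + p⌋₊ = m := by
      rw [Nat.floor_eq_iff (by positivity)]
      constructor <;> linarith
    rw [interpolation, h1, Int.fract_natCast_add, Int.fract_eq_self.2 ⟨hp0, hp1⟩]
  rcases hp.2.eq_or_lt with rfl | hlt
  · have := key (m + 1) 0 le_rfl one_pos
    rw [add_zero, h0, mul_zero, add_zero] at this
    push_cast at this
    rw [this, h1]
    ring
  · exact key m p hp.1 hlt

theorem interpolation_eqOn {g : ℝ → ℝ} (h0 : g 0 = 0) (h1 : g 1 = 1) (m : ℕ) :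
    Set.EqOn (interpolation H g) (fun x => H m + ((H (m + 1) : ℝ) - H m) * g (x - m))
      (Set.Icc (m : ℝ) (m + 1)) := by
  intro x hx
  have := interpolation_natCast_add (H := H) h0 h1 m (p := x - m)
    ⟨by linarith [hx.1], by linarith [hx.2]⟩
  rwa [add_sub_cancel] at this

theorem interpolation_on_Icc (hH : IsFundamentalSequence L H) {g : ℝ → ℝ}
    (hc : ContinuousOn g (Set.Icc 0 1)) (hm : StrictMonoOn g (Set.Icc 0 1)) (h0 : g 0 = 0)
    (h1 : g 1 = 1) (n : ℕ) (hn : 1 ≤ n) :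
    ContinuousOn (interpolation H g) (Set.Icc 1 (n : ℝ)) ∧
      StrictMonoOn (interpolation H g) (Set.Icc 1 (n : ℝ)) := by
  induction n, hn using Nat.le_induction with
  | base => simp
  | succ n hn ih =>
    have hn' : (1 : ℝ) ≤ n := by exact_mod_cast hn
    have hmaps : Set.MapsTo (fun x : ℝ => x - n) (Set.Icc (n : ℝ) (n + 1)) (Set.Icc 0 1) :=
      fun x hx => ⟨by linarith [hx.1], by linarith [hx.2]⟩
    have heq := interpolation_eqOn (H := H) h0 h1 n
    have hunion : Set.Icc (1 : ℝ) n ∪ Set.Icc (n : ℝ) (n + 1) = Set.Icc 1 ((n + 1 : ℕ) : ℝ) := by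
      push_cast
      exact Set.Icc_union_Icc_eq_Icc hn' (by linarith)
    rw [← hunion]
    constructor
    · refine ih.1.union_of_isClosed ?_ isClosed_Icc isClosed_Icc
      refine ContinuousOn.congr ?_ heq
      exact continuousOn_const.add (continuousOn_const.mul
        (hc.comp (continuousOn_id.sub continuousOn_const) hmaps))
    · refine ih.2.union ?_ (isGreatest_Icc hn') (isLeast_Icc (by linarith))
      refine StrictMonoOn.congr (fun x hx y hy hxy => ?_) heq.symm
      have h2 := hm (hmaps hx) (hmaps hy) (show x - n < y - n by linarith)
      have h3 := mul_lt_mul_of_pos_left h2 (hH.gap_pos hn)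
      linarith

/-- Every piece equals `g` on `[0, 1]`, so the uniform convergence is trivial. -/
theorem isUniformContinuation_interpolation (hH : IsFundamentalSequence L H) {g : ℝ → ℝ}
    (hc : ContinuousOn g (Set.Icc 0 1)) (hm : StrictMonoOn g (Set.Icc 0 1)) (h0 : g 0 = 0)
    (h1 : g 1 = 1) :
    IsUniformContinuation H (interpolation H g) ∧
      Set.EqOn (limitPiece (interpolation H g)) g (Set.Icc 0 1) := by
  have hIcc := interpolation_on_Icc hH hc hm h0 h1
  have hnat : ∀ n : ℕ, interpolation H g n = H n := fun n => by
    have := interpolation_natCast_add (H := H) h0 h1 n (p := 0) (by simp)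
    simpa [h0] using this
  have hpiece : ∀ n : ℕ, 1 ≤ n → Set.EqOn (piece (interpolation H g) n) g (Set.Icc 0 1) := by
    intro n hn p hp
    have h2 : interpolation H g ((n : ℝ) + 1) = H (n + 1) := by exact_mod_cast hnat (n + 1)
    have h3 := hH.gap_pos hn
    rw [piece, interpolation_natCast_add h0 h1 n hp, h2, hnat, add_sub_cancel_left,
      mul_div_cancel_left₀ _ h3.ne']
  refine ⟨⟨?_, ?_, fun n _ => hnat n, g, hc, hm, ?_⟩, ?_⟩
  · intro x hx
    obtain ⟨n, hn⟩ := exists_nat_gt x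
    have hx1 : (1 : ℝ) ≤ x := hx
    have hn1 : 1 ≤ n := by
      have : (1 : ℝ) < n := by linarith
      exact_mod_cast this.le
    refine ((hIcc n hn1).1 x ⟨hx1, hn.le⟩).mono_of_mem_nhdsWithin ?_
    rw [← Set.Ici_inter_Iic]
    exact inter_mem self_mem_nhdsWithin (mem_nhdsWithin_of_mem_nhds (Iic_mem_nhds hn))
  · intro x hx y hy hxy
    obtain ⟨n, hn⟩ := exists_nat_gt y
    have hx1 : (1 : ℝ) ≤ x := hx
    have hn1 : 1 ≤ n := by
      have : (1 : ℝ) < n := by linarith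
      exact_mod_cast this.le
    exact (hIcc n hn1).2 ⟨hx1, by linarith⟩ ⟨hy, hn.le⟩ hxy
  · rw [Metric.tendstoUniformlyOn_iff]
    intro η hη
    filter_upwards [eventually_ge_atTop 1] with n hn p hp
    rw [hpiece n hn hp, dist_self]
    exact hη
  · intro p hp
    refine Tendsto.limUnder_eq (tendsto_const_nhds.congr' ?_)
    filter_upwards [eventually_ge_atTop 1] with n hn
    exact (hpiece n hn hp).symm

theorem invUnit_homeomorph {f : ℝ → ℝ} (hc : ContinuousOn f (Set.Icc 0 1))
    (hm : StrictMonoOn f (Set.Icc 0 1)) (h0 : f 0 = 0) (h1 : f 1 = 1) :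
    ContinuousOn (invUnit f) (Set.Icc 0 1) ∧ StrictMonoOn (invUnit f) (Set.Icc 0 1) ∧
      invUnit f 0 = 0 ∧ invUnit f 1 = 1 := by
  have hspec := fun y (hy : y ∈ Set.Icc (0 : ℝ) 1) => invUnit_spec hc h0 h1 hy
  have hleft : ∀ p ∈ Set.Icc (0 : ℝ) 1, invUnit f (f p) = p := fun p hp =>
    hm.injOn.leftInvOn_invFunOn hp
  refine ⟨fun y hy => ?_, fun y hy z hz hyz => ?_, ?_, ?_⟩
  · refine tendsto_of_strictMonoOn hm (hspec y hy).1 ?_ ?_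
    · filter_upwards [self_mem_nhdsWithin] with z hz using (hspec z hz).1
    · rw [(hspec y hy).2]
      refine (tendsto_nhdsWithin_of_tendsto_nhds tendsto_id).congr' ?_
      filter_upwards [self_mem_nhdsWithin] with z hz using (hspec z hz).2.symm
  · rw [← hm.lt_iff_lt (hspec y hy).1 (hspec z hz).1, (hspec y hy).2, (hspec z hz).2]
    exact hyz
  · simpa [h0] using hleft 0 (by simp)
  · simpa [h1] using hleft 1 (by simp)

/-- Interpolate with `g = f⁻¹`. The fractional part of `h⁻¹(K_n)` is at most `β` exactly when the
relative position of `K_n` is at most `f⁻¹(β)`, an event of density `f(f⁻¹(β)) = β`. -/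
theorem HasContinuousLeadingBlockDistribution.exists_continuation (hN : 2 ≤ L.length)
    (hL : 0 < entry L 1) (hH : IsFundamentalSequence L H) {K : ℕ → ℕ} {f : ℝ → ℝ}
    (hK : HasContinuousLeadingBlockDistribution L H K f) :
    ∃ h : ℝ → ℝ, IsUniformContinuation H h ∧
      Set.EqOn (invUnit (limitPiece h)) f (Set.Icc 0 1) ∧
      FractEquidistributed (fun n => invHalfLine h (K n)) := by
  have h0 := hK.isHStar.zero
  have h1 := hK.isHStar.one
  obtain ⟨hgc, hgm, hg0, hg1⟩ := invUnit_homeomorph hK.continuousOn hK.increasing h0 h1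
  obtain ⟨hh, heq⟩ := isUniformContinuation_interpolation hH hgc hgm hg0 hg1
  refine ⟨_, hh, fun y hy => ?_, fun β hβ => ?_⟩
  · obtain ⟨hc', -, -, h0', h1'⟩ := hh.limitPiece_spec hH
    obtain ⟨hp, hpy⟩ := invUnit_spec hc' h0' h1' hy
    rw [heq hp] at hpy
    have := (invUnit_spec hK.continuousOn h0 h1 hp).2
    rw [hpy] at this
    exact this.symm
  · obtain ⟨lev, hlev⟩ := hH.exists_level hL
    obtain ⟨hp, hpβ⟩ := invUnit_spec hK.continuousOn h0 h1 hβ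
    have hdens := hK.hasDensity hN hL hH hlev hp
    rw [hpβ] at hdens
    refine hdens.congr ?_
    filter_upwards [eventually_ge_atTop 1] with n hn
    obtain ⟨hm, hl1, hl2⟩ := hlev _ (hK.posToInfinity.1 n hn)
    rw [hh.fract_inv_le_iff hm (by exact_mod_cast hl1) (by exact_mod_cast hl2) hβ.1,
      interpolation_natCast_add hg0 hg1 _ hβ]

end

end GenZeckendorf

end

/-! ### Assembly of the theorem. -/

theorem theorem5p18 (L : List ℕ) (hN : 2 ≤ L.length) (hL : 0 < GenZeckendorf.entry L 1)
    (H : ℕ → ℕ) (hH : GenZeckendorf.IsFundamentalSequence L H) :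
    (∀ h : ℝ → ℝ, GenZeckendorf.IsUniformContinuation H h →
      (∃ K : ℕ → ℕ,
        (∀ n : ℕ, 1 ≤ n → K n =
          ⌊GenZeckendorf.benford L H
            (n + GenZeckendorf.invUnit (GenZeckendorf.piece (GenZeckendorf.benford L H) n)
              (GenZeckendorf.piece h n (Int.fract (n * Real.pi))))⌋₊) ∧
        GenZeckendorf.PosToInfinity K ∧
        GenZeckendorf.FractEquidistributed (fun n => GenZeckendorf.invHalfLine h (K n))) ∧
      (∀ K : ℕ → ℕ, GenZeckendorf.PosToInfinity K →
        GenZeckendorf.FractEquidistributed (fun n => GenZeckendorf.invHalfLine h (K n)) →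
        ∀ s : ℕ, 1 ≤ s → ∀ b ∈ GenZeckendorf.leadingBlocks L H s,
          GenZeckendorf.HasDensity (fun n => GenZeckendorf.HasLeadingBlock L H s (K n) b)
            (GenZeckendorf.invUnit (GenZeckendorf.limitPiece h)
                (GenZeckendorf.limitPiece (GenZeckendorf.benford L H)
                  (Real.logb (GenZeckendorf.psi L)
                    (GenZeckendorf.dot (GenZeckendorf.succBlock L H s b)
                      (GenZeckendorf.Hhat L))))
              - GenZeckendorf.invUnit (GenZeckendorf.limitPiece h)
                (GenZeckendorf.limitPiece (GenZeckendorf.benford L H)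
                  (Real.logb (GenZeckendorf.psi L)
                    (GenZeckendorf.dot b (GenZeckendorf.Hhat L))))) ∧
          GenZeckendorf.HasDensity (fun n => GenZeckendorf.HasLeadingBlock L H s (K n) b)
            (GenZeckendorf.invUnit (GenZeckendorf.limitPiece h)
                ((GenZeckendorf.dot (GenZeckendorf.succBlock L H s b) (GenZeckendorf.Hhat L) - 1)
                  / (GenZeckendorf.psi L - 1))
              - GenZeckendorf.invUnit (GenZeckendorf.limitPiece h)
                ((GenZeckendorf.dot b (GenZeckendorf.Hhat L) - 1)
                  / (GenZeckendorf.psi L - 1))))) ∧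
    (∀ (K : ℕ → ℕ) (hKstar : ℝ → ℝ),
      GenZeckendorf.HasContinuousLeadingBlockDistribution L H K hKstar →
      ∃ h : ℝ → ℝ, GenZeckendorf.IsUniformContinuation H h ∧
        Set.EqOn (GenZeckendorf.invUnit (GenZeckendorf.limitPiece h)) hKstar (Set.Icc 0 1) ∧
        GenZeckendorf.FractEquidistributed (fun n => GenZeckendorf.invHalfLine h (K n))) := by
  obtain ⟨hψ, -⟩ := GenZeckendorf.psi_spec hN hL
  -- The sequence is given directly through `h`; the Benford formula reduces to it for `n ≥ 1` by
  -- `benford_inv_piece`.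
  refine ⟨fun h hh => ⟨⟨fun n => ⌊h (n + Int.fract (n * Real.pi))⌋₊, fun n hn => ?_, ?_⟩, ?_⟩, ?_⟩
  · have hn' : (1 : ℝ) ≤ n := by exact_mod_cast hn
    have h1 := Int.fract_nonneg ((n : ℝ) * Real.pi)
    have h2 := Int.fract_lt_one ((n : ℝ) * Real.pi)
    have hgap := hH.gap_pos hn
    have h3 : h n ≤ h (n + Int.fract (n * Real.pi)) :=
      hh.increasing.monotoneOn hn' (show (1 : ℝ) ≤ _ by linarith) (by linarith)
    have h4 : h (n + Int.fract (n * Real.pi)) ≤ h (n + 1) :=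
      hh.increasing.monotoneOn (show (1 : ℝ) ≤ _ by linarith) (show (1 : ℝ) ≤ _ by linarith)
        (by linarith)
    rw [hh.interpolates n hn] at h3
    rw [hh.apply_add_one] at h4
    have hy : GenZeckendorf.piece h n (Int.fract (n * Real.pi)) ∈ Set.Icc (0 : ℝ) 1 := by
      rw [hh.piece_eq hn]
      exact ⟨div_nonneg (by linarith) hgap.le, (div_le_one hgap).2 (by linarith)⟩
    rw [GenZeckendorf.benford_inv_piece hψ hH hn hy, hh.piece_eq hn, mul_div_cancel₀ _ hgap.ne',
      add_sub_cancel]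
  · exact hh.floor_sequence hN hL hH
      (GenZeckendorf.fractEquidistributed_mul_irrational irrational_pi)
  · intro K hK hEq s hs b hb
    obtain ⟨h1, h2, h3⟩ := GenZeckendorf.hasDensity_leadingBlock hN hL hH hh hK hEq hs hb
    rw [GenZeckendorf.limitPiece_benford_logb hψ hH h1,
      GenZeckendorf.limitPiece_benford_logb hψ hH h2]
    exact ⟨h3, h3⟩
  · exact fun K f hK => hK.exists_continuation hN hL hH
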